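/- Let $F(\mathbf x)=f(\mathbf x)+h(\mathbf x)$ on $\mathbb R^n$ with the Euclidean norm, $h(\mathbf x)=\sum_{i=1}^n h_i(\mathbf x_i)$, where $f$ and the $h_i:\mathbb R\to\mathbb R$ are convex, $f$ is differentiable, and $|\nabla_i f(\mathbf x)-\nabla_i f(\mathbf y)|\le L_c|\mathbf x_i-\mathbf y_i|$ whenever $\mathbf x,\mathbf y$ differ only in the $i$-th coordinate. Let $\mathbf x^*$ be a minimizer of $F$. AASCD with parameters $\theta^k$, step size $\gamma>0$ and delay bound $\tau\in\mathbb N$, $\tau\le\sqrt n$, starts from $\mathbf x^0=\mathbf z^0=\mathbf 0$. Put $\mathbf y^k=(1-\theta^k)\mathbf x^k+\theta^k\mathbf z^k$, $a^k=\theta^k(1-\theta^{k-1})/\theta^{k-1}$ and $b(l,k)=\prod_{i=l}^k a^i$. For $k=0,1,2,\dots$ some $j(k)\in\{k-\tau,\dots,k\}$, $j(k)\ge 0$, is given, an index $i_k\in\{1,\dots,n\}$ is drawn uniformly, independently of all earlier indices and of $j(0),\dots,j(k)$, and $$\mathbf w^{j(k)}=\mathbf y^{j(k)}+\Big(\sum_{i=j(k)+1}^{k}b(j(k)+1,i)\Big)(\mathbf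 y^{j(k)}-\mathbf x^{j(k)}),$$ $$\delta^k=\operatorname*{argmin}_{\delta\in\mathbb R}\; h_{i_k}(\mathbf z^k_{i_k}+\delta)+\nabla_{i_k}f(\mathbf w^{j(k)})\,\delta+\frac{n\theta^k}{2\gamma}\delta^2,$$ $$\mathbf z^{k+1}=\mathbf z^k+\delta^k e_{i_k},\qquad \mathbf x^{k+1}=(1-\theta^k)\mathbf x^k+n\theta^k\mathbf z^{k+1}-(n-1)\theta^k\mathbf z^k .$$ Each iteration costs one (incremental first-order) oracle call, the evaluation of $\nabla_{i_k}f(\mathbf w^{j(k)})$. Let $N(\varepsilon)$ be the least number of calls after which $\mathbb E[F(\mathbf x^k)]-F(\mathbf x^*)\le\varepsilon$ holds for all later iterates, and let $Q=\frac{\tau^2+\tau}{n}+2\tau$. (Non-strongly convex case.) Suppose in addition that $\nabla f$ is $L$-Lipschitz, $L\ge L_c$, that $\theta^k=\frac{2}{2n+k}$, and that $c\le 2\gamma L_c+(1+\frac1n)\gamma L_cQ^2\le 1$ for some $c>0$. If $\|\mathbf x^*\|\le R$ and $F(\mathbf 0)-F(\mathbf x^*)\le A L$, then for all $\varepsilon>0$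 $$N(\varepsilon)\le C\,\big(n\sqrt L+n\tau\sqrt{L_c}\big)\sqrt{1/\varepsilon},$$ where $C$ depends only on $c$, $A$, $R$. (Strongly convex case.) Suppose in addition that $h$ is strongly convex with modulus $\mu$, $0<\mu\le L_c$, that $\theta^k=\theta=\frac{-\gamma\mu+\sqrt{\gamma^2\mu^2+4\gamma\mu}}{2n}$, and that $c\le 2\gamma L_c+(\frac34+\frac{3}{8n})\gamma L_cQ^2\le 1$ for some $c>0$. If $F(\mathbf 0)-F(\mathbf x^*)\le A$, then for all $0<\varepsilon\le\frac12$ $$N(\varepsilon)\le C\,n\max\{\tau,1\}\sqrt{L_c/\mu}\,\log(1/\varepsilon),$$ where $C$ depends only on $c$, $A$. -/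

import Mathlib

open MeasureTheory ProbabilityTheory

namespace AASCD

noncomputable section

/-- The space `ℝⁿ` with the Euclidean norm. -/
abbrev Vec (n : ℕ) : Type := EuclideanSpace ℝ (Fin n)

/-- The separable part `h(x) = ∑ᵢ hᵢ(xᵢ)`. -/
def separable {n : ℕ} (h : Fin n → ℝ → ℝ) (x : Vec n) : ℝ :=
  ∑ i, h i (x i)

/-- The objective `F(x) = f(x) + ∑ᵢ hᵢ(xᵢ)`. -/
def objective {n : ℕ} (f : Vec n → ℝ) (h : Fin n → ℝ → ℝ) (x : Vec n) : ℝ :=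
  f x + separable h x

/-- `∇f` is `Lc`-Lipschitz along coordinates: if `x` and `y` differ only in the `i`-th coordinate,
then `|∇ᵢf(x) - ∇ᵢf(y)| ≤ Lc |xᵢ - yᵢ|`. -/
def CoordLipschitzGradient {n : ℕ} (f : Vec n → ℝ) (Lc : ℝ) : Prop :=
  ∀ (i : Fin n) (x y : Vec n), (∀ l, l ≠ i → x l = y l) →
    |gradient f x i - gradient f y i| ≤ Lc * |x i - y i|

/-- `∇f` is `L`-Lipschitz for the Euclidean norm. -/
def LipschitzGradient {n : ℕ} (f : Vec n → ℝ) (L : ℝ) : Prop :=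
  ∀ x y : Vec n, ‖gradient f x - gradient f y‖ ≤ L * ‖y - x‖

/-- The composite convex problem `min_x f(x) + ∑ᵢ hᵢ(xᵢ)` over `ℝⁿ`, with minimizer `xstar`. -/
structure IsProblem {n : ℕ} (f : Vec n → ℝ) (h : Fin n → ℝ → ℝ) (Lc : ℝ) (xstar : Vec n) :
    Prop where
  convex_f : ConvexOn ℝ Set.univ f
  differentiable_f : Differentiable ℝ f
  coordLipschitz_f : CoordLipschitzGradient f Lc
  convex_h : ∀ i, ConvexOn ℝ Set.univ (h i)
  isMin : ∀ x, objective f h xstar ≤ objective f h x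

/-- The momentum coefficient `a^k = θ^k (1 - θ^(k-1)) / θ^(k-1)`, only used for `k ≥ 1`. -/
def momentum (θ : ℕ → ℝ) (k : ℕ) : ℝ :=
  θ k * (1 - θ (k - 1)) / θ (k - 1)

/-- `b(l, k) = ∏_{i=l}^{k} aⁱ`. -/
def momentumProd (θ : ℕ → ℝ) (l k : ℕ) : ℝ :=
  ∏ i ∈ Finset.Icc l k, momentum θ i

/-- One trajectory of AASCD with parameters `θ`, step size `γ`, chosen coordinates `idx k` and
read states `j k`. The extrapolation point used at iteration `k` is `w k`. -/
structure IsTrajectory {n : ℕ} (f : Vec n → ℝ) (h : Fin n → ℝ → ℝ) (θ : ℕ → ℝ) (γ : ℝ)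
    (idx : ℕ → Fin n) (j : ℕ → ℕ) (x y z w : ℕ → Vec n) (δ : ℕ → ℝ) : Prop where
  x_zero : x 0 = 0
  z_zero : z 0 = 0
  y_eq : ∀ k, y k = (1 - θ k) • x k + θ k • z k
  w_eq : ∀ k, w k = y (j k) +
    (∑ i ∈ Finset.Icc (j k + 1) k, momentumProd θ (j k + 1) i) • (y (j k) - x (j k))
  /-- `δᵏ` minimizes
  `δ ↦ h_{i_k}(zᵏ_{i_k} + δ) + ∇_{i_k} f(w) δ + (n θᵏ / (2 γ)) δ²`. -/
  δ_isMin : ∀ k (d : ℝ),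
    h (idx k) (z k (idx k) + δ k) + gradient f (w k) (idx k) * δ k
        + n * θ k / (2 * γ) * δ k ^ 2
      ≤ h (idx k) (z k (idx k) + d) + gradient f (w k) (idx k) * d
        + n * θ k / (2 * γ) * d ^ 2
  z_succ : ∀ k, z (k + 1) = z k + EuclideanSpace.single (idx k) (δ k)
  x_succ : ∀ k, x (k + 1) =
    (1 - θ k) • x k + (n * θ k) • z (k + 1) - (((n : ℝ) - 1) * θ k) • z k

/-- The random execution: `idx k` is uniform on the coordinates and independent of everything that
happened before it is drawn (the past `ℱ k`, which includes the earlier choices and the read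
states up to `j k`), and the delays are bounded: `j(k) ∈ {k - τ, …, k}`. -/
structure IsExecution {n : ℕ} {Ω : Type*} {mΩ : MeasurableSpace Ω} (P : Measure Ω)
    (ℱ : Filtration ℕ mΩ) (τ : ℕ) (idx : ℕ → Ω → Fin n) (j : ℕ → Ω → ℕ) : Prop where
  idx_measurable : ∀ k, Measurable[ℱ (k + 1)] (idx k)
  idx_uniform : ∀ k a, P (idx k ⁻¹' {a}) = (n : ENNReal)⁻¹
  idx_indep : ∀ k, Indep (MeasurableSpace.comap (idx k) ⊤) (ℱ k) P
  j_measurable : ∀ k, Measurable[ℱ k] (j k)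
  j_le : ∀ k ω, j k ω ≤ k
  le_j_add : ∀ k ω, k ≤ j k ω + τ

/-- The number of incremental first-order oracle calls made to compute `xᵏ`: each iteration makes
exactly one call, for the partial derivative of `f` at `w` in the chosen coordinate. -/
def oracleCalls : ℕ → ℕ
  | 0 => 0
  | k + 1 => oracleCalls k + 1

/-- After `N` oracle calls, the expected objective error of the iterates is at most `ε`. -/
def ReachesAccuracy {n : ℕ} {Ω : Type*} {mΩ : MeasurableSpace Ω} (P : Measure Ω)
    (F : Vec n → ℝ) (xstar : Vec n) (x : ℕ → Ω → Vec n) (ε : ℝ) (N : ℕ) : Prop :=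
  ∀ k, N ≤ oracleCalls k →
    Integrable (fun ω => F (x k ω)) P ∧ ∫ ω, F (x k ω) ∂P - F xstar ≤ ε

/-- `θᵏ = 2 / (2n + k)`, used without strong convexity. -/
def thetaNC (n : ℕ) (k : ℕ) : ℝ :=
  2 / (2 * n + k)

/-- The constant `θ`, the positive root of `n²θ² + nγμθ - γμ = 0`, used with strong convexity. -/
def thetaSC (n : ℕ) (γ μ : ℝ) (_k : ℕ) : ℝ :=
  (-(γ * μ) + Real.sqrt (γ ^ 2 * μ ^ 2 + 4 * γ * μ)) / (2 * n)

/-- The left-hand side of the step size condition without strong convexity. -/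
def stepNC (n τ : ℕ) (Lc γ : ℝ) : ℝ :=
  2 * γ * Lc + (1 + 1 / n) * γ * Lc * (((τ : ℝ) ^ 2 + τ) / n + 2 * τ) ^ 2

/-- The left-hand side of the step size condition with strong convexity. -/
def stepSC (n τ : ℕ) (Lc γ : ℝ) : ℝ :=
  2 * γ * Lc + (3 / 4 + 3 / (8 * n)) * γ * Lc * (((τ : ℝ) ^ 2 + τ) / n + 2 * τ) ^ 2

end

end AASCD

/-!
The proof is an energy argument along every single trajectory; the randomness enters only through
one noise term of mean zero.

Write `s = n θᵏ δᵏ`, so that `xᵏ⁺¹ = yᵏ + s eᵢ`. A convex function whose partial derivatives are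
`Lc`-Lipschitz along coordinates is `Lc`-smooth for the `ℓ¹` norm (`l1_descent`). Expanding `f` at
`w`, where the gradient was read, and not at `y`, gives
`f(xᵏ⁺¹) ≤ f(w) + ⟨∇f(w), xᵏ⁺¹ - w⟩ + Lc (‖y - w‖₁² + s²)`. Together with the tangent inequality
at `w`, the three-point inequality of the proximal step (`prox_ineq`), and the fact that `xᵏ` is a
convex combination of `z⁰, …, zᵏ`, so that `h(xᵏ)` may be replaced by the corresponding combination
of the values `h(zˡ)` (`IsTrajectory.separable_le`), this is the recursion
`IsTrajectory.one_step`. Its only term that depends on the drawn coordinate other than through the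
new state is `samplingNoise`, which averages to zero over a uniform coordinate.

The extrapolation makes `w` differ from `y` only by the steps taken since the state `j(k)` was
read, the step made `d` iterations ago having a factor of at most `1 + d / n`
(`IsTrajectory.extrapolation_error`). These factors add up to `Q / 2`, so by Cauchy-Schwarz the
accumulated `‖y - w‖₁²` is at most `r (Q / 2)²` times the accumulated `s²`, where `r` bounds the
growth of the summation weights within the delay (`IsTrajectory.sum_l1_sub_sq_le`). The squared
steps come with the negative coefficient `-(1 / (2 γ) - Lc)`, and the step size condition says
exactly that this absorbs the error for `r = 2 (1 + 1 / n)`, respectively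
`r = 2 (3 / 4 + 3 / (8 n))`. The weights are `1 / (θᵏ)²` without strong convexity and
`(1 - θ)⁻⁽ᵏ⁺¹⁾` with it; their growth is controlled by `τ ≤ √n` (`isWeight_thetaNC`) and by
`θ τ ≤ 1 / 3` (`mul_thetaSC_le`).

The minimizer `δᵏ` is unique, so the iterates are functions of the finitely many choices made
before (`IsTrajectory.state_congr`). This gives integrability, and measurability with respect to the
past, so that independence of the next draw makes the noise vanish in expectation
(`integral_samplingNoise`, `integral_error_le`). What remains is to solve the resulting bounds
`O(n² / k²)` and `2 (1 - θ)ᵏ (F(0) - F(x*))` for `k`.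
-/

namespace AASCD

/-! ### Convexity and smoothness in the `ℓ¹` norm -/

/-- The `ℓ¹` norm on `ℝⁿ`, in which a function that is smooth along coordinates is smooth with the
same constant. -/
noncomputable def l1 {n : ℕ} (v : Vec n) : ℝ := ∑ i, |v i|

lemma l1_nonneg {n : ℕ} (v : Vec n) : 0 ≤ l1 v :=
  Finset.sum_nonneg fun _ _ => abs_nonneg _

lemma l1_zero {n : ℕ} : l1 (0 : Vec n) = 0 := by simp [l1]

lemma l1_add_le {n : ℕ} (u v : Vec n) : l1 (u + v) ≤ l1 u + l1 v := by
  unfold l1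
  rw [← Finset.sum_add_distrib]
  exact Finset.sum_le_sum fun i _ => by simpa using abs_add_le (u i) (v i)

lemma l1_smul {n : ℕ} (c : ℝ) (v : Vec n) : l1 (c • v) = |c| * l1 v := by
  simp [l1, abs_mul, Finset.mul_sum]

lemma l1_single {n : ℕ} (i : Fin n) (t : ℝ) : l1 (EuclideanSpace.single i t : Vec n) = |t| := by
  unfold l1
  rw [Finset.sum_eq_single i] <;> simp +contextual

lemma inner_single {n : ℕ} (g : Vec n) (i : Fin n) (t : ℝ) :
    inner ℝ g (EuclideanSpace.single i t : Vec n) = g i * t := by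
  simp [EuclideanSpace.inner_single_right, mul_comm]

lemma inner_eq_sum {n : ℕ} (g v : Vec n) : inner ℝ g v = ∑ i, g i * v i := by
  simp [PiLp.inner_apply, mul_comm]

lemma hasDerivAt_line {n : ℕ} {f : Vec n → ℝ} (hf : Differentiable ℝ f) (w v : Vec n) (t : ℝ) :
    HasDerivAt (fun r : ℝ => f (w + r • v)) (inner ℝ (gradient f (w + t • v)) v) t := by
  have h1 := (hf (w + t • v)).hasGradientAt.hasFDerivAt
  have h2 : HasDerivAt (fun r : ℝ => w + r • v) v t := by
    simpa using ((hasDerivAt_id t).smul_const v).const_add w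
  have h3 := h1.comp_hasDerivAt t h2
  rw [InnerProductSpace.toDual_apply_apply] at h3
  exact h3

/-- A differentiable convex function lies above its tangents. -/
lemma tangent_le {n : ℕ} {f : Vec n → ℝ} (hc : ConvexOn ℝ Set.univ f) (hf : Differentiable ℝ f)
    (w u : Vec n) : f w + inner ℝ (gradient f w) (u - w) ≤ f u := by
  have hline : ConvexOn ℝ Set.univ (fun r : ℝ => f (w + r • (u - w))) := by
    refine ⟨convex_univ, fun a _ b _ s t hs ht hst => ?_⟩
    have := hc.2 (Set.mem_univ (w + a • (u - w))) (Set.mem_univ (w + b • (u - w))) hs ht hst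
    refine le_trans (le_of_eq ?_) this
    obtain rfl : s = 1 - t := by linarith
    show f _ = f _
    congr 1
    simp only [smul_eq_mul]
    module
  have hd := hasDerivAt_line hf w (u - w) 0
  have := hline.le_slope_of_hasDerivAt (Set.mem_univ 0) (Set.mem_univ 1) one_pos hd
  simp only [slope_def_field, zero_smul, add_zero, one_smul, add_sub_cancel, sub_zero,
    div_one] at this
  linarith

lemma coord_descent {n : ℕ} {f : Vec n → ℝ} {Lc : ℝ} (hf : Differentiable ℝ f)
    (hL : CoordLipschitzGradient f Lc) (w : Vec n) (i : Fin n) (t : ℝ) :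
    f (w + EuclideanSpace.single i t) ≤ f w + gradient f w i * t + Lc / 2 * t ^ 2 := by
  set e : Vec n := EuclideanSpace.single i t with he
  have hd : ∀ r : ℝ, HasDerivAt
      (fun r : ℝ => r * (gradient f w i * t) + Lc / 2 * t ^ 2 * r ^ 2 - f (w + r • e))
      (gradient f w i * t + Lc * t ^ 2 * r - gradient f (w + r • e) i * t) r := by
    intro r
    have h1 := hasDerivAt_line hf w e r
    rw [he, inner_single, ← he] at h1
    refine ((((hasDerivAt_id r).mul_const (gradient f w i * t)).add
      ((hasDerivAt_pow 2 r).const_mul (Lc / 2 * t ^ 2))).sub h1).congr_deriv ?_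
    simp
    ring
  have hmono : MonotoneOn
      (fun r : ℝ => r * (gradient f w i * t) + Lc / 2 * t ^ 2 * r ^ 2 - f (w + r • e))
      (Set.Icc 0 1) := by
    refine monotoneOn_of_deriv_nonneg (convex_Icc 0 1)
      (fun r _ => (hd r).continuousAt.continuousWithinAt)
      (fun r _ => (hd r).differentiableAt.differentiableWithinAt) fun r hr => ?_
    rw [interior_Icc] at hr
    rw [(hd r).deriv]
    have h1 := hL i (w + r • e) w (fun l hl => by simp [he, hl])
    have h2 : (w + r • e) i - w i = r * t := by simp [he]
    rw [h2, abs_mul, abs_of_pos hr.1] at h1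
    have h3 : (gradient f (w + r • e) i - gradient f w i) * t ≤ Lc * (r * |t|) * |t| := by
      refine (le_abs_self _).trans ?_
      rw [abs_mul]
      exact mul_le_mul_of_nonneg_right h1 (abs_nonneg t)
    have h4 : Lc * (r * |t|) * |t| = Lc * t ^ 2 * r := by
      rw [← sq_abs t]; ring
    linarith
  have := hmono (Set.left_mem_Icc.2 zero_le_one) (Set.right_mem_Icc.2 zero_le_one) zero_le_one
  simp at this
  linarith

/-- Smoothness along coordinates and convexity give smoothness in the `ℓ¹` norm: `w + v` is a convex
combination of the points `w ± ‖v‖₁ eᵢ`, with weights `|vᵢ| / ‖v‖₁`. -/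
lemma l1_descent {n : ℕ} {f : Vec n → ℝ} {Lc : ℝ} (hc : ConvexOn ℝ Set.univ f)
    (hf : Differentiable ℝ f) (hL : CoordLipschitzGradient f Lc) (w v : Vec n) :
    f (w + v) ≤ f w + inner ℝ (gradient f w) v + Lc / 2 * l1 v ^ 2 := by
  rcases (l1_nonneg v).eq_or_lt with h0 | hpos
  · have hv : v = 0 := by
      ext i
      have := (Finset.sum_eq_zero_iff_of_nonneg (fun i _ => abs_nonneg (v i))).1 h0.symm i
        (Finset.mem_univ i)
      simpa using this
    simp [hv, l1_zero]
  set S := l1 v with hS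
  have hsum : ∑ i, |v i| / S = 1 := by
    rw [← Finset.sum_div]; exact div_self hpos.ne'
  have hsgn : ∀ i, |v i| / S * (SignType.sign (v i) * S) = v i := by
    intro i
    have := abs_mul_sign (v i)
    field_simp
    linarith
  have hcomb : w + v = ∑ i, (|v i| / S) •
      (w + (EuclideanSpace.single i ((SignType.sign (v i) : ℝ) * S) : Vec n)) := by
    simp only [smul_add, Finset.sum_add_distrib, ← Finset.sum_smul, hsum, one_smul]
    congr 1
    ext l
    simp only [WithLp.ofLp_sum, Finset.sum_apply, PiLp.smul_apply, PiLp.single_apply, smul_eq_mul]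
    rw [Finset.sum_eq_single l] <;> simp +contextual [hsgn, eq_comm]
  have h1 := hc.map_sum_le (t := Finset.univ) (w := fun i => |v i| / S)
    (p := fun i => w + (EuclideanSpace.single i ((SignType.sign (v i) : ℝ) * S) : Vec n))
    (fun i _ => by positivity) hsum (fun i _ => Set.mem_univ _)
  rw [hcomb]
  refine h1.trans ?_
  have h2 : ∀ i, (|v i| / S) • f (w + (EuclideanSpace.single i ((SignType.sign (v i) : ℝ) * S)))
      ≤ |v i| / S * (f w + Lc / 2 * S ^ 2) + gradient f w i * v i := by
    intro i
    have h3 := coord_descent hf hL w i ((SignType.sign (v i) : ℝ) * S)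
    have hw : 0 ≤ |v i| / S := by positivity
    rcases eq_or_ne (v i) 0 with hv | hv
    · simp [hv]
    have h4 : ((SignType.sign (v i) : ℝ) * S) ^ 2 = S ^ 2 := by
      rcases hv.lt_or_gt with hv | hv <;> simp [hv]
    rw [h4] at h3
    have h5 := mul_le_mul_of_nonneg_left h3 hw
    have h6 := hsgn i
    rw [smul_eq_mul]
    refine h5.trans (le_of_eq ?_)
    linear_combination gradient f w i * h6
  refine (Finset.sum_le_sum fun i _ => h2 i).trans (le_of_eq ?_)
  rw [Finset.sum_add_distrib, ← Finset.sum_mul, hsum, inner_eq_sum]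
  ring

/-- Quadratic growth of a strongly convex function around its minimizer. -/
lemma growth_of_isMin {E : Type*} [NormedAddCommGroup E] [NormedSpace ℝ E] {G : E → ℝ} {m : ℝ}
    (hG : StrongConvexOn Set.univ m G) {p : E} (hp : ∀ q, G p ≤ G q) (q : E) :
    G p + m / 2 * ‖p - q‖ ^ 2 ≤ G q := by
  have key : ∀ t ∈ Set.Ioo (0 : ℝ) 1, G p + (1 - t) * (m / 2 * ‖p - q‖ ^ 2) ≤ G q := by
    intro t ht
    have h1 := hG.2 (Set.mem_univ p) (Set.mem_univ q) (sub_nonneg.2 ht.2.le) ht.1.le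
      (sub_add_cancel 1 t)
    have h2 := (hp _).trans h1
    simp only [smul_eq_mul] at h2
    have h3 : t * (G p + (1 - t) * (m / 2 * ‖p - q‖ ^ 2)) ≤ t * G q := by linarith
    exact le_of_mul_le_mul_left h3 ht.1
  have hlim : Filter.Tendsto (fun t : ℝ => G p + (1 - t) * (m / 2 * ‖p - q‖ ^ 2))
      (nhdsWithin 0 (Set.Ioi 0)) (nhds (G p + (1 - 0) * (m / 2 * ‖p - q‖ ^ 2))) :=
    (Continuous.tendsto (by fun_prop) 0).mono_left nhdsWithin_le_nhds
  have := le_of_tendsto hlim (Filter.eventually_of_mem (Ioo_mem_nhdsGT one_pos) key)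
  simpa using this

/-! ### The proximal step and separable functions -/

lemma strongConvexOn_prox {h : ℝ → ℝ} {μ : ℝ} (hh : StrongConvexOn Set.univ μ h) (z g q : ℝ) :
    StrongConvexOn Set.univ (q + μ) (fun d => h (z + d) + g * d + q / 2 * d ^ 2) := by
  refine ⟨convex_univ, fun a _ b _ s t hs ht hst => ?_⟩
  have h1 := hh.2 (Set.mem_univ (z + a)) (Set.mem_univ (z + b)) hs ht hst
  obtain rfl : s = 1 - t := by linarith
  have h2 : (1 - t) • (z + a) + t • (z + b) = z + ((1 - t) • a + t • b) := by
    simp only [smul_eq_mul]; ring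
  have h3 : z + a - (z + b) = a - b := by ring
  rw [h2, h3] at h1
  simp only [smul_eq_mul, Real.norm_eq_abs, sq_abs] at h1 ⊢
  linarith

/-- The three-point inequality of a proximal step. -/
lemma prox_ineq {h : ℝ → ℝ} {μ z g q δ : ℝ} (hh : StrongConvexOn Set.univ μ h)
    (hδ : ∀ d, h (z + δ) + g * δ + q / 2 * δ ^ 2 ≤ h (z + d) + g * d + q / 2 * d ^ 2) (u : ℝ) :
    h (z + δ) + g * δ ≤ h u + g * (u - z)
      + q / 2 * ((z - u) ^ 2 - δ ^ 2 - (z + δ - u) ^ 2) - μ / 2 * (z + δ - u) ^ 2 := by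
  have h1 := growth_of_isMin (strongConvexOn_prox hh z g q) hδ (u - z)
  have h2 : z + (u - z) = u := by ring
  simp only [Real.norm_eq_abs, sq_abs, h2] at h1
  linarith

lemma prox_unique {h : ℝ → ℝ} {z g q δ δ' : ℝ} (hh : ConvexOn ℝ Set.univ h) (hq : 0 < q)
    (hδ : ∀ d, h (z + δ) + g * δ + q / 2 * δ ^ 2 ≤ h (z + d) + g * d + q / 2 * d ^ 2)
    (hδ' : ∀ d, h (z + δ') + g * δ' + q / 2 * δ' ^ 2 ≤ h (z + d) + g * d + q / 2 * d ^ 2) :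
    δ = δ' := by
  have h1 := growth_of_isMin (strongConvexOn_prox (strongConvexOn_zero.2 hh) z g q) hδ δ'
  have h2 := hδ' δ
  have h3 : q / 2 * ‖δ - δ'‖ ^ 2 ≤ 0 := by
    simp only [add_zero] at h1
    linarith
  have h4 : ‖δ - δ'‖ ^ 2 ≤ 0 := by
    by_contra hcon
    push Not at hcon
    have : 0 < q / 2 * ‖δ - δ'‖ ^ 2 := by positivity
    linarith
  have h5 : ‖δ - δ'‖ = 0 := by
    have := sq_nonneg ‖δ - δ'‖
    exact pow_eq_zero_iff two_ne_zero |>.1 (le_antisymm h4 this)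
  exact sub_eq_zero.1 (norm_eq_zero.1 h5)

lemma separable_single {n : ℕ} (h : Fin n → ℝ → ℝ) (v : Vec n) (i : Fin n) (t : ℝ) :
    separable h (v + EuclideanSpace.single i t) = separable h v + (h i (v i + t) - h i (v i)) := by
  unfold separable
  have h1 := Finset.sum_erase_add Finset.univ (fun l => h l ((v + EuclideanSpace.single i t) l))
    (Finset.mem_univ i)
  have h2 := Finset.sum_erase_add Finset.univ (fun l => h l (v l)) (Finset.mem_univ i)
  have h3 : ∑ l ∈ Finset.univ.erase i, h l ((v + EuclideanSpace.single i t : Vec n) l)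
      = ∑ l ∈ Finset.univ.erase i, h l (v l) :=
    Finset.sum_congr rfl fun l hl => by simp [Finset.ne_of_mem_erase hl]
  have h4 : (v + EuclideanSpace.single i t : Vec n) i = v i + t := by simp
  rw [← h1, ← h2, h3]
  simp only [h4]
  ring

lemma convexOn_separable {n : ℕ} {h : Fin n → ℝ → ℝ} (hh : ∀ i, ConvexOn ℝ Set.univ (h i)) :
    ConvexOn ℝ Set.univ (separable h) := by
  refine ⟨convex_univ, fun a _ b _ s t hs ht hst => ?_⟩
  simp only [separable, smul_eq_mul, Finset.mul_sum, ← Finset.sum_add_distrib]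
  exact Finset.sum_le_sum fun i _ => by
    simpa using (hh i).2 (Set.mem_univ (a i)) (Set.mem_univ (b i)) hs ht hst

lemma strongConvexOn_coord {n : ℕ} {h : Fin n → ℝ → ℝ} {μ : ℝ}
    (hh : StrongConvexOn Set.univ μ (separable h)) (i : Fin n) :
    StrongConvexOn Set.univ μ (h i) := by
  refine ⟨convex_univ, fun a _ b _ s t hs ht hst => ?_⟩
  have h1 := hh.2 (Set.mem_univ (EuclideanSpace.single i a : Vec n))
    (Set.mem_univ (EuclideanSpace.single i b)) hs ht hst
  have h2 : s • (EuclideanSpace.single i a : Vec n) + t • EuclideanSpace.single i b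
      = EuclideanSpace.single i (s • a + t • b) := by
    ext l
    rcases eq_or_ne l i with rfl | hl <;> simp [*]
  have h3 : ∀ c, separable h (EuclideanSpace.single i c)
      = separable h 0 + (h i c - h i 0) := fun c => by
    simpa using separable_single h 0 i c
  have h4 : ‖(EuclideanSpace.single i a : Vec n) - EuclideanSpace.single i b‖ = ‖a - b‖ := by
    rw [← dist_eq_norm, ← dist_eq_norm, PiLp.dist_single_same]
  rw [h2, h3, h3, h3, h4] at h1
  simp only [smul_eq_mul] at h1 ⊢
  obtain rfl : s = 1 - t := by linarith
  linarith

/-! ### Estimates along a trajectory -/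

/-- The length of the coordinate step `xᵏ⁺¹ - yᵏ = n θᵏ δᵏ eᵢ`. -/
noncomputable def stepLen (n : ℕ) (θ δ : ℕ → ℝ) (k : ℕ) : ℝ := n * θ k * δ k

/-- The part of the estimate for a proximal step in coordinate `i` that is fixed before the step is
made: the change, from `zᵢ` to the reference value `xsᵢ`, of `hᵢ` plus the linear model of `f` with
the gradient read at `w`, corrected by the modulus `μ` of strong convexity. -/
noncomputable def coordGain {n : ℕ} (f : Vec n → ℝ) (h : Fin n → ℝ → ℝ) (μ : ℝ) (xs z w : Vec n)
    (i : Fin n) : ℝ :=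
  h i (xs i) - h i (z i) + gradient f w i * (xs i - z i) - μ / 2 * (z i - xs i) ^ 2

/-- The sampling error of drawing coordinate `i`; it vanishes on average over a uniform `i`. -/
noncomputable def samplingNoise {n : ℕ} (f : Vec n → ℝ) (h : Fin n → ℝ → ℝ) (μ : ℝ) (xs z w : Vec n)
    (i : Fin n) : ℝ :=
  n * coordGain f h μ xs z w i - ∑ l, coordGain f h μ xs z w l

lemma sum_coordGain {n : ℕ} (f : Vec n → ℝ) (h : Fin n → ℝ → ℝ) (μ : ℝ) (xs z w : Vec n) :
    ∑ l, coordGain f h μ xs z w l = separable h xs - separable h z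
      + inner ℝ (gradient f w) (xs - z) - μ / 2 * ‖z - xs‖ ^ 2 := by
  simp only [coordGain, Finset.sum_add_distrib, Finset.sum_sub_distrib, ← Finset.mul_sum,
    separable, inner_eq_sum, EuclideanSpace.real_norm_sq_eq, PiLp.sub_apply]

/-- The surrogate `ĥᵏ` of `h(xᵏ)`: the combination of the values `h(zˡ)` with the weights with which
`xᵏ` is a combination of the points `zˡ`. -/
noncomputable def hSurrogate {n : ℕ} (h : Fin n → ℝ → ℝ) (θ : ℕ → ℝ) (z : ℕ → Vec n) : ℕ → ℝ
  | 0 => separable h (z 0)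
  | k + 1 => (1 - θ k) * hSurrogate h θ z k + n * θ k * separable h (z (k + 1))
      - (n - 1) * θ k * separable h (z k)

/-- The parameters used by the analysis are positive, non-increasing and at most `1 / n`. -/
structure IsAdmissible (n : ℕ) (θ : ℕ → ℝ) : Prop where
  one_le : (1 : ℝ) ≤ n
  pos : ∀ k, 0 < θ k
  mul_le_one : ∀ k, n * θ k ≤ 1
  anti : ∀ k, θ (k + 1) ≤ θ k

lemma IsAdmissible.le_one {n : ℕ} {θ : ℕ → ℝ} (hθ : IsAdmissible n θ) (k : ℕ) : θ k ≤ 1 :=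
  (le_mul_of_one_le_left (hθ.pos k).le hθ.one_le).trans (hθ.mul_le_one k)

section Path

variable {n : ℕ} {f : Vec n → ℝ} {h : Fin n → ℝ → ℝ} {θ : ℕ → ℝ} {γ : ℝ}
  {idx : ℕ → Fin n} {j : ℕ → ℕ} {x y z w : ℕ → Vec n} {δ : ℕ → ℝ}

lemma IsTrajectory.x_succ_eq (T : IsTrajectory f h θ γ idx j x y z w δ) (k : ℕ) :
    x (k + 1) = y k + EuclideanSpace.single (idx k) (stepLen n θ δ k) := by
  have hs : (EuclideanSpace.single (idx k) (stepLen n θ δ k) : Vec n)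
      = (n * θ k) • EuclideanSpace.single (idx k) (δ k) := by
    ext l; rcases eq_or_ne l (idx k) with rfl | hl <;> simp [stepLen, *]
  rw [T.x_succ, T.z_succ, T.y_eq, hs]
  module

/-- The iterate `xᵏ` is a convex combination of `z⁰, …, zᵏ`. The weight `β` of `zᵏ` is `1` for
`k = 0` and `n θᵏ⁻¹` afterwards; its lower bound `n θᵏ` keeps the weights of the next iterate nonnegative,
in which `zᵏ` enters with the negative contribution `-(n - 1) θᵏ`. -/
lemma IsTrajectory.exists_weights (T : IsTrajectory f h θ γ idx j x y z w δ)
    (hθ : IsAdmissible n θ) (k : ℕ) :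
    ∃ (e : ℕ → ℝ) (β : ℝ), (∀ l, 0 ≤ e l) ∧ n * θ k ≤ β ∧
      ∑ l ∈ Finset.range k, e l + β = 1 ∧
      x k = ∑ l ∈ Finset.range k, e l • z l + β • z k ∧
      hSurrogate h θ z k
        = ∑ l ∈ Finset.range k, e l * separable h (z l) + β * separable h (z k) := by
  induction k with
  | zero => exact ⟨0, 1, by simp, hθ.mul_le_one 0, by simp, by simp [T.x_zero, T.z_zero],
      by simp [hSurrogate]⟩
  | succ k ih =>
    obtain ⟨e, β, he, hβ, h1, hx, hh⟩ := ih
    have hsum : ∀ {E : Type} [AddCommMonoid E] (c : ℝ → ℕ → E),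
        ∑ l ∈ Finset.range (k + 1),
          c (if l < k then (1 - θ k) * e l else (1 - θ k) * β - (n - 1) * θ k) l
        = ∑ l ∈ Finset.range k, c ((1 - θ k) * e l) l
          + c ((1 - θ k) * β - (n - 1) * θ k) k := by
      intro E _ c
      rw [Finset.sum_range_succ]
      congr 1
      · exact Finset.sum_congr rfl fun l hl => by rw [if_pos (Finset.mem_range.1 hl)]
      · simp
    have hθ1 := hθ.le_one k
    refine ⟨fun l => if l < k then (1 - θ k) * e l else (1 - θ k) * β - (n - 1) * θ k,
      n * θ k, fun l => ?_, ?_, ?_, ?_, ?_⟩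
    · dsimp only
      split_ifs
      · exact mul_nonneg (by linarith) (he l)
      · have h2 : (1 - θ k) * (n * θ k) ≤ (1 - θ k) * β :=
          mul_le_mul_of_nonneg_left hβ (by linarith)
        have h3 := mul_le_mul_of_nonneg_left (hθ.mul_le_one k) (hθ.pos k).le
        nlinarith
    · exact mul_le_mul_of_nonneg_left (hθ.anti k) (by positivity)
    · rw [hsum (fun r _ => r), ← Finset.mul_sum]
      linear_combination (1 - θ k) * h1
    · rw [hsum (fun r l => r • z l), T.x_succ, hx]
      simp only [mul_smul, ← Finset.smul_sum]
      module
    · rw [hsum (fun r l => r * separable h (z l))]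
      simp only [mul_assoc, ← Finset.mul_sum, hSurrogate]
      rw [hh]
      ring

lemma IsTrajectory.separable_le (T : IsTrajectory f h θ γ idx j x y z w δ)
    (hθ : IsAdmissible n θ) (hh : ∀ i, ConvexOn ℝ Set.univ (h i)) (k : ℕ) :
    separable h (x k) ≤ hSurrogate h θ z k := by
  obtain ⟨e, β, he, hβ, h1, hx, hs⟩ := T.exists_weights hθ k
  have h2 := (convexOn_separable hh).map_sum_le (t := Finset.range (k + 1))
    (w := fun l => if l < k then e l else β) (p := z) (fun l _ => by
      split_ifs
      · exact he l
      · exact le_trans (mul_nonneg (by positivity) (hθ.pos k).le) hβ) ?_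
    (fun _ _ => Set.mem_univ _)
  · rw [Finset.sum_range_succ, Finset.sum_range_succ] at h2
    have h3 : ∑ l ∈ Finset.range k, (if l < k then e l else β) • z l
        = ∑ l ∈ Finset.range k, e l • z l :=
      Finset.sum_congr rfl fun l hl => by rw [if_pos (Finset.mem_range.1 hl)]
    have h4 : ∑ l ∈ Finset.range k, (if l < k then e l else β) • separable h (z l)
        = ∑ l ∈ Finset.range k, e l * separable h (z l) :=
      Finset.sum_congr rfl fun l hl => by rw [if_pos (Finset.mem_range.1 hl), smul_eq_mul]
    rw [h3, h4, if_neg (lt_irrefl k), ← hx, smul_eq_mul, ← hs] at h2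
    exact h2
  · rw [Finset.sum_range_succ, if_neg (lt_irrefl k), ← h1]
    congr 1
    exact Finset.sum_congr rfl fun l hl => by rw [if_pos (Finset.mem_range.1 hl)]

/-- The inertia `yᵏ - xᵏ` decays by the momentum coefficient and is refreshed by the last step. -/
lemma IsTrajectory.inertia_succ (T : IsTrajectory f h θ γ idx j x y z w δ)
    (hθ : IsAdmissible n θ) (k : ℕ) :
    y (k + 1) - x (k + 1) = momentum θ (k + 1) • (y k - x k)
      + (θ (k + 1) * (1 / (n * θ k) - 1)) •
        EuclideanSpace.single (idx k) (stepLen n θ δ k) := by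
  have hn : (n : ℝ) ≠ 0 := by linarith [hθ.one_le]
  have ht := (hθ.pos k).ne'
  have hs : (EuclideanSpace.single (idx k) (stepLen n θ δ k) : Vec n)
      = (n * θ k) • EuclideanSpace.single (idx k) (δ k) := by
    ext l; rcases eq_or_ne l (idx k) with rfl | hl <;> simp [stepLen, *]
  rw [T.y_eq (k + 1), T.x_succ_eq, T.z_succ, T.y_eq k, hs]
  ext l
  simp only [momentum, Nat.add_sub_cancel, PiLp.add_apply, PiLp.sub_apply, PiLp.smul_apply,
    smul_eq_mul]
  field_simp
  ring

lemma momentum_succ_mem {n : ℕ} {θ : ℕ → ℝ} (hθ : IsAdmissible n θ) (k : ℕ) :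
    0 ≤ momentum θ (k + 1) ∧ momentum θ (k + 1) ≤ 1 := by
  have h0 := hθ.pos k
  have h1 := hθ.pos (k + 1)
  have h2 := hθ.le_one k
  have h3 := hθ.anti k
  simp only [momentum, Nat.add_sub_cancel]
  refine ⟨div_nonneg (mul_nonneg h1.le (by linarith)) h0.le, ?_⟩
  rw [div_le_one h0]
  nlinarith

/-- The momentum compensation: with respect to the state `m`, the extrapolated point misses only
the later steps, the step `l` with a factor of at most `1 + (k - l) / n`. -/
lemma IsTrajectory.extrapolation_error (T : IsTrajectory f h θ γ idx j x y z w δ)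
    (hθ : IsAdmissible n θ) {m k : ℕ} (hmk : m ≤ k) :
    l1 (y k - x k - momentumProd θ (m + 1) k • (y m - x m))
        ≤ ∑ l ∈ Finset.Ico m k, 1 / n * |stepLen n θ δ l| ∧
      l1 (y k - (y m + (∑ i ∈ Finset.Icc (m + 1) k, momentumProd θ (m + 1) i) • (y m - x m)))
        ≤ ∑ l ∈ Finset.Ico m k, (1 + ((k : ℝ) - l) / n) * |stepLen n θ δ l| := by
  have hn : (0 : ℝ) < n := by linarith [hθ.one_le]
  induction k, hmk using Nat.le_induction with
  | base => simp [momentumProd, l1_zero]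
  | succ k hmk ih =>
    obtain ⟨ih1, ih2⟩ := ih
    set s := stepLen n θ δ k with hs
    set E : Vec n := EuclideanSpace.single (idx k) s with hE
    have hprod : momentumProd θ (m + 1) (k + 1)
        = momentum θ (k + 1) * momentumProd θ (m + 1) k := by
      unfold momentumProd
      rw [Finset.prod_Icc_succ_top (by omega), mul_comm]
    have hcoef : 0 ≤ θ (k + 1) * (1 / (n * θ k) - 1) ∧
        θ (k + 1) * (1 / (n * θ k) - 1) ≤ 1 / n := by
      have h0 := hθ.pos k
      have h1 := hθ.pos (k + 1)
      have h2 := hθ.mul_le_one k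
      have h3 := hθ.anti k
      have h4 : 1 ≤ 1 / (n * θ k) := by
        rw [le_div_iff₀ (by positivity)]; linarith
      refine ⟨mul_nonneg h1.le (by linarith), ?_⟩
      have h5 : θ (k + 1) * (1 / (n * θ k) - 1) ≤ θ k * (1 / (n * θ k) - 1) :=
        mul_le_mul_of_nonneg_right h3 (by linarith)
      have h6 : θ k * (1 / (n * θ k) - 1) = 1 / n - θ k := by field_simp
      linarith
    have hr : y (k + 1) - x (k + 1) - momentumProd θ (m + 1) (k + 1) • (y m - x m)
        = momentum θ (k + 1) • (y k - x k - momentumProd θ (m + 1) k • (y m - x m))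
          + (θ (k + 1) * (1 / (n * θ k) - 1)) • E := by
      rw [T.inertia_succ hθ k, hprod]
      module
    have h1 : l1 (y (k + 1) - x (k + 1) - momentumProd θ (m + 1) (k + 1) • (y m - x m))
        ≤ ∑ l ∈ Finset.Ico m (k + 1), 1 / n * |stepLen n θ δ l| := by
      rw [hr, Finset.sum_Ico_succ_top hmk]
      obtain ⟨ha0, ha1⟩ := momentum_succ_mem hθ k
      refine (l1_add_le _ _).trans (add_le_add ?_ ?_)
      · rw [l1_smul, abs_of_nonneg ha0]
        exact (mul_le_of_le_one_left (l1_nonneg _) ha1).trans ih1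
      · rw [l1_smul, abs_of_nonneg hcoef.1, hE, l1_single]
        exact mul_le_mul_of_nonneg_right hcoef.2 (abs_nonneg _)
    refine ⟨h1, ?_⟩
    have he : y (k + 1)
          - (y m + (∑ i ∈ Finset.Icc (m + 1) (k + 1), momentumProd θ (m + 1) i) • (y m - x m))
        = (y k - (y m + (∑ i ∈ Finset.Icc (m + 1) k, momentumProd θ (m + 1) i) • (y m - x m)))
          + E + (y (k + 1) - x (k + 1) - momentumProd θ (m + 1) (k + 1) • (y m - x m)) := by
      rw [Finset.sum_Icc_succ_top (by omega), T.x_succ_eq k]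
      module
    rw [he]
    refine ((l1_add_le _ _).trans
      (add_le_add ((l1_add_le _ _).trans (add_le_add ih2 le_rfl)) h1)).trans (le_of_eq ?_)
    rw [hE, l1_single, Finset.sum_Ico_succ_top hmk, Finset.sum_Ico_succ_top hmk]
    have h2 : ∑ l ∈ Finset.Ico m k, (1 + (((k + 1 : ℕ) : ℝ) - l) / n) * |stepLen n θ δ l|
        = ∑ l ∈ Finset.Ico m k, (1 + ((k : ℝ) - l) / n) * |stepLen n θ δ l|
          + ∑ l ∈ Finset.Ico m k, 1 / n * |stepLen n θ δ l| := by
      rw [← Finset.sum_add_distrib]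
      refine Finset.sum_congr rfl fun l _ => ?_
      push_cast
      ring
    rw [h2, ← hs]
    push_cast
    ring

/-- Half of the quantity `Q`: the sum of the factors with which the last `τ` steps enter the
extrapolation error. -/
noncomputable def delayMass (n τ : ℕ) : ℝ := (((τ : ℝ) ^ 2 + τ) / n + 2 * τ) / 2

lemma sum_lag (n τ : ℕ) :
    ∑ d ∈ Finset.Ico 1 (τ + 1), (1 + (d : ℝ) / n) = delayMass n τ := by
  induction τ with
  | zero => simp [delayMass]
  | succ τ ih =>
    rw [Finset.sum_Ico_succ_top (by omega), ih]
    simp only [delayMass]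
    push_cast
    ring

lemma sum_lag_before (n τ k : ℕ) :
    ∑ l ∈ Finset.Ico (k - τ) k, (1 + ((k : ℝ) - l) / n) ≤ delayMass n τ := by
  have h1 := Finset.sum_Ico_reflect (fun d : ℕ => 1 + (d : ℝ) / n) (k - τ) (Nat.le_succ k)
  have h2 : ∑ l ∈ Finset.Ico (k - τ) k, (1 + ((k : ℝ) - l) / n)
      = ∑ l ∈ Finset.Ico (k - τ) k, (1 + ((k - l : ℕ) : ℝ) / n) :=
    Finset.sum_congr rfl fun l hl => by rw [Nat.cast_sub (Finset.mem_Ico.1 hl).2.le]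
  rw [h2, h1, ← sum_lag]
  refine Finset.sum_le_sum_of_subset_of_nonneg (Finset.Ico_subset_Ico (by omega) (by omega))
    fun d _ _ => by positivity

lemma sum_lag_after (n τ l : ℕ) :
    ∑ k ∈ Finset.Ioc l (l + τ), (1 + ((k : ℝ) - l) / n) = delayMass n τ := by
  rw [← sum_lag]
  refine Finset.sum_nbij' (fun k => k - l) (fun d => d + l) ?_ ?_ ?_ ?_ ?_
  · intro k hk; simp only [Finset.mem_Ioc, Finset.mem_Ico] at hk ⊢; omega
  · intro k hk; simp only [Finset.mem_Ioc, Finset.mem_Ico] at hk ⊢; omega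
  · intro k hk; simp only [Finset.mem_Ioc] at hk; omega
  · intro k hk; simp
  · intro k hk
    rw [Nat.cast_sub (Finset.mem_Ioc.1 hk).1.le]

/-- The Cauchy-Schwarz inequality applied to `IsTrajectory.extrapolation_error`. -/
lemma IsTrajectory.l1_sub_sq_le (T : IsTrajectory f h θ γ idx j x y z w δ)
    (hθ : IsAdmissible n θ) {τ k : ℕ} (hjk : j k ≤ k) (hkj : k ≤ j k + τ) :
    l1 (y k - w k) ^ 2 ≤ delayMass n τ *
      ∑ l ∈ Finset.Ico (k - τ) k, (1 + ((k : ℝ) - l) / n) * stepLen n θ δ l ^ 2 := by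
  have hc : ∀ l ∈ Finset.Ico (k - τ) k, (0 : ℝ) ≤ 1 + ((k : ℝ) - l) / n := fun l hl => by
    have : (l : ℝ) ≤ k := by exact_mod_cast (Finset.mem_Ico.1 hl).2.le
    have : (0 : ℝ) ≤ (k : ℝ) - l := by linarith
    positivity
  have h1 : l1 (y k - w k)
      ≤ ∑ l ∈ Finset.Ico (k - τ) k, (1 + ((k : ℝ) - l) / n) * |stepLen n θ δ l| := by
    rw [T.w_eq k]
    refine (T.extrapolation_error hθ hjk).2.trans ?_
    exact Finset.sum_le_sum_of_subset_of_nonneg (Finset.Ico_subset_Ico (by omega) le_rfl)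
      fun l hl _ => mul_nonneg (hc l hl) (abs_nonneg _)
  have h2 : (∑ l ∈ Finset.Ico (k - τ) k, (1 + ((k : ℝ) - l) / n) * |stepLen n θ δ l|) ^ 2
      ≤ (∑ l ∈ Finset.Ico (k - τ) k, (1 + ((k : ℝ) - l) / n)) *
        ∑ l ∈ Finset.Ico (k - τ) k, (1 + ((k : ℝ) - l) / n) * stepLen n θ δ l ^ 2 :=
    Finset.sum_sq_le_sum_mul_sum_of_sq_le_mul _ hc
      (fun l hl => mul_nonneg (hc l hl) (sq_nonneg _))
      (fun l _ => le_of_eq (by rw [mul_pow, sq_abs]; ring))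
  refine (pow_le_pow_left₀ (l1_nonneg _) h1 2).trans (h2.trans ?_)
  exact mul_le_mul_of_nonneg_right (sum_lag_before n τ k)
    (Finset.sum_nonneg fun l hl => mul_nonneg (hc l hl) (sq_nonneg _))

/-- The inequality of one iteration, along a trajectory. -/
lemma IsTrajectory.one_step (T : IsTrajectory f h θ γ idx j x y z w δ)
    (hθ : IsAdmissible n θ) {Lc μ : ℝ} {xs : Vec n} (hP : IsProblem f h Lc xs) (hLc : 0 ≤ Lc)
    (hγ : 0 < γ)
    (hh : ∀ i, StrongConvexOn Set.univ μ (h i)) (k : ℕ) :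
    f (x (k + 1)) + hSurrogate h θ z (k + 1) - objective f h xs
      ≤ (1 - θ k) * (f (x k) + hSurrogate h θ z k - objective f h xs)
        + n ^ 2 * θ k ^ 2 / (2 * γ) * (‖z k - xs‖ ^ 2 - ‖z (k + 1) - xs‖ ^ 2)
        - θ k * μ / 2 * (n * ‖z (k + 1) - xs‖ ^ 2 - (n - 1) * ‖z k - xs‖ ^ 2)
        - (1 / (2 * γ) - Lc) * stepLen n θ δ k ^ 2
        + Lc * l1 (y k - w k) ^ 2
        + θ k * samplingNoise f h μ xs (z k) (w k) (idx k) := by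
  set i := idx k with hi
  set g := gradient f (w k) with hg
  set s := stepLen n θ δ k with hs
  have hθ0 := hθ.pos k
  have hθ1 := hθ.le_one k
  have hn : (0 : ℝ) < n := by linarith [hθ.one_le]
  -- smoothness around the point at which the gradient was read
  have hf1 : f (x (k + 1)) ≤ f (w k) + inner ℝ g (y k - w k) + g i * s
      + Lc * (l1 (y k - w k) ^ 2 + s ^ 2) := by
    have e1 : x (k + 1) = w k + ((y k - w k) + EuclideanSpace.single i s) := by
      rw [T.x_succ_eq k]; abel
    have e2 := l1_descent hP.convex_f hP.differentiable_f hP.coordLipschitz_f (w k)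
      ((y k - w k) + EuclideanSpace.single i s)
    rw [← e1, inner_add_right, inner_single] at e2
    have e3 : l1 ((y k - w k) + EuclideanSpace.single i s) ≤ l1 (y k - w k) + |s| := by
      simpa [l1_single] using l1_add_le (y k - w k) (EuclideanSpace.single i s)
    have e4 : l1 ((y k - w k) + EuclideanSpace.single i s) ^ 2
        ≤ 2 * (l1 (y k - w k) ^ 2 + s ^ 2) := by
      refine (pow_le_pow_left₀ (l1_nonneg _) e3 2).trans ?_
      rw [← sq_abs s]
      nlinarith [sq_nonneg (l1 (y k - w k) - |s|)]
    have e5 := mul_le_mul_of_nonneg_left e4 (show 0 ≤ Lc / 2 by linarith)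
    linarith
  -- convexity at the same point
  have hf2 := tangent_le hP.convex_f hP.differentiable_f (w k) xs
  have hf3 := tangent_le hP.convex_f hP.differentiable_f (w k) (x k)
  have hf4 : f (w k) + inner ℝ g (y k - w k) + θ k * inner ℝ g (xs - z k)
      ≤ θ k * f xs + (1 - θ k) * f (x k) := by
    have e1 : inner ℝ g (y k - w k) + θ k * inner ℝ g (xs - z k)
        = θ k * inner ℝ g (xs - w k) + (1 - θ k) * inner ℝ g (x k - w k) := by
      rw [← inner_smul_right, ← inner_smul_right, ← inner_smul_right, ← inner_add_right,
        ← inner_add_right, T.y_eq k]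
      congr 1
      module
    have e2 := mul_le_mul_of_nonneg_left hf2 hθ0.le
    have e3 := mul_le_mul_of_nonneg_left hf3 (show 0 ≤ 1 - θ k by linarith)
    linarith
  -- the proximal step
  have hprox := prox_ineq (q := n * θ k / γ) (hh i) (z := z k i) (g := g i) (δ := δ k)
    (fun d => by
      have e1 := T.δ_isMin k d
      have e2 : (n : ℝ) * θ k / γ / 2 = n * θ k / (2 * γ) := by field_simp
      rw [e2]
      exact e1) (xs i)
  have hprox' := mul_le_mul_of_nonneg_left hprox (mul_pos hn hθ0).le
  have hz : separable h (z (k + 1))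
      = separable h (z k) + (h i (z k i + δ k) - h i (z k i)) := by
    rw [T.z_succ, separable_single]
  have hD : ‖z (k + 1) - xs‖ ^ 2
      = ‖z k - xs‖ ^ 2 + ((z k i + δ k - xs i) ^ 2 - (z k i - xs i) ^ 2) := by
    have := separable_single (fun l t => (t - xs l) ^ 2) (z k) i (δ k)
    rw [T.z_succ, EuclideanSpace.real_norm_sq_eq, EuclideanSpace.real_norm_sq_eq]
    simpa [separable] using this
  have hsd : s = n * θ k * δ k := rfl
  have hq1 : (n : ℝ) * θ k * (n * θ k / γ / 2) = n ^ 2 * θ k ^ 2 / (2 * γ) := by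
    field_simp
  have hq2 : (n : ℝ) ^ 2 * θ k ^ 2 / (2 * γ) * δ k ^ 2 = 1 / (2 * γ) * s ^ 2 := by
    rw [hsd]; field_simp
  have hpr : (n : ℝ) * θ k * (n * θ k / γ / 2 * ((z k i - xs i) ^ 2 - δ k ^ 2
        - (z k i + δ k - xs i) ^ 2))
      = n ^ 2 * θ k ^ 2 / (2 * γ) * ((z k i - xs i) ^ 2 - (z k i + δ k - xs i) ^ 2)
        - 1 / (2 * γ) * s ^ 2 := by
    rw [← hq2, ← hq1]; ring
  simp only [hSurrogate, samplingNoise, sum_coordGain, objective]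
  rw [hz, hD]
  simp only [coordGain, ← hg]
  have hgs : g i * s = n * θ k * (g i * δ k) := by rw [hsd]; ring
  generalize inner ℝ g (y k - w k) = A1 at *
  generalize inner ℝ g (xs - z k) = A2 at *
  generalize (n : ℝ) ^ 2 * θ k ^ 2 / (2 * γ) = c1 at *
  generalize 1 / (2 * γ) = c2 at *
  linarith

end Path

/-! ### Summation over the iterations -/

section Path

variable {n : ℕ} {f : Vec n → ℝ} {h : Fin n → ℝ → ℝ} {θ : ℕ → ℝ} {γ : ℝ}
  {idx : ℕ → Fin n} {j : ℕ → ℕ} {x y z w : ℕ → Vec n} {δ : ℕ → ℝ}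

/-- The weights with which the inequalities of the single iterations are added up. The ratio `r`
measures how much the weights can grow within the delay. -/
structure IsWeight (n τ : ℕ) (θ : ℕ → ℝ) (γ μ r : ℝ) (W : ℕ → ℝ) : Prop where
  pos : ∀ k, 0 < W k
  value_le : ∀ k, W (k + 1) * (1 - θ (k + 1)) ≤ W k
  dist_le : ∀ k, W (k + 1) * (n ^ 2 * θ (k + 1) ^ 2 / (2 * γ) + (n - 1) * θ (k + 1) * μ / 2)
    ≤ W k * (n ^ 2 * θ k ^ 2 / (2 * γ) + n * θ k * μ / 2)
  growth : ∀ l k, l ≤ k → k ≤ l + τ → W k ≤ r * W l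

/-- Every step is charged only to the `τ` iterations that may still read an older state, so that
the accumulated extrapolation error is absorbed by the squared steps. -/
lemma IsTrajectory.sum_l1_sub_sq_le (T : IsTrajectory f h θ γ idx j x y z w δ)
    (hθ : IsAdmissible n θ) {τ : ℕ} (hjk : ∀ k, j k ≤ k) (hkj : ∀ k, k ≤ j k + τ) {μ r : ℝ}
    {W : ℕ → ℝ} (hW : IsWeight n τ θ γ μ r W) (N : ℕ) :
    ∑ k ∈ Finset.range N, W k * l1 (y k - w k) ^ 2
      ≤ r * delayMass n τ ^ 2 * ∑ l ∈ Finset.range N, W l * stepLen n θ δ l ^ 2 := by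
  have hn : (0 : ℝ) < n := by linarith [hθ.one_le]
  have hr : 0 ≤ r := by
    have h1 := hW.growth 0 0 le_rfl (by omega)
    have h2 := hW.pos 0
    by_contra hcon
    push Not at hcon
    nlinarith
  have hm : 0 ≤ delayMass n τ := by unfold delayMass; positivity
  have hlag : ∀ {l k : ℕ}, l ≤ k → (0 : ℝ) ≤ 1 + ((k : ℝ) - l) / n := fun {l k} hl => by
    have h1 : (l : ℝ) ≤ k := by exact_mod_cast hl
    have : (0 : ℝ) ≤ (k : ℝ) - l := by linarith
    positivity
  set S : ℕ → ℝ := fun l => r * (W l * stepLen n θ δ l ^ 2) with hS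
  have hS0 : ∀ l, 0 ≤ S l := fun l =>
    mul_nonneg hr (mul_nonneg (hW.pos l).le (sq_nonneg _))
  have h1 : ∀ k ∈ Finset.range N, W k * l1 (y k - w k) ^ 2
      ≤ delayMass n τ * ∑ l ∈ Finset.Ico (k - τ) k, (1 + ((k : ℝ) - l) / n) * S l := by
    intro k _
    refine (mul_le_mul_of_nonneg_left (T.l1_sub_sq_le hθ (hjk k) (hkj k))
      (hW.pos k).le).trans ?_
    rw [mul_left_comm, Finset.mul_sum]
    refine mul_le_mul_of_nonneg_left (Finset.sum_le_sum fun l hl => ?_) hm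
    rw [Finset.mem_Ico] at hl
    have h2 := hW.growth l k hl.2.le (by omega)
    have h3 := mul_le_mul_of_nonneg_right h2
      (mul_nonneg (hlag hl.2.le) (sq_nonneg (stepLen n θ δ l)))
    refine h3.trans (le_of_eq ?_)
    rw [hS]
    ring
  refine (Finset.sum_le_sum h1).trans ?_
  rw [← Finset.mul_sum, Finset.sum_comm' (s' := fun l =>
    (Finset.Ioc l (l + τ)).filter (fun k => k < N)) (t' := Finset.range N) (by
      intro k l
      simp only [Finset.mem_range, Finset.mem_Ico, Finset.mem_filter, Finset.mem_Ioc]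
      omega)]
  have h4 : ∀ l ∈ Finset.range N,
      ∑ k ∈ (Finset.Ioc l (l + τ)).filter (fun k => k < N), (1 + ((k : ℝ) - l) / n) * S l
        ≤ delayMass n τ * S l := by
    intro l _
    rw [← Finset.sum_mul]
    refine mul_le_mul_of_nonneg_right ?_ (hS0 l)
    rw [← sum_lag_after n τ l]
    exact Finset.sum_le_sum_of_subset_of_nonneg (Finset.filter_subset _ _)
      fun k hk _ => hlag (Finset.mem_Ioc.1 hk).1.le
  refine (mul_le_mul_of_nonneg_left (Finset.sum_le_sum h4) hm).trans (le_of_eq ?_)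
  rw [← Finset.mul_sum, hS, ← Finset.mul_sum]
  ring

/-- The initial energy, which bounds the weighted error up to sampling noise. -/
noncomputable def initialEnergy {n : ℕ} (f : Vec n → ℝ) (h : Fin n → ℝ → ℝ) (θ : ℕ → ℝ)
    (γ μ : ℝ) (W : ℕ → ℝ) (xs : Vec n) : ℝ :=
  W 0 * (1 - θ 0) * (objective f h 0 - objective f h xs)
    + W 0 * (n ^ 2 * θ 0 ^ 2 / (2 * γ) + (n - 1) * θ 0 * μ / 2) * ‖xs‖ ^ 2

/-- The weighted sum of the one-step inequalities, in which the objective and the distance terms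
telescope. -/
lemma IsTrajectory.energy_le (T : IsTrajectory f h θ γ idx j x y z w δ)
    (hθ : IsAdmissible n θ) {Lc μ : ℝ} {xs : Vec n} (hP : IsProblem f h Lc xs) (hLc : 0 ≤ Lc)
    (hγ : 0 < γ) (hh : ∀ i, StrongConvexOn Set.univ μ (h i)) {τ : ℕ} {r : ℝ} {W : ℕ → ℝ}
    (hW : IsWeight n τ θ γ μ r W) (K : ℕ) :
    W K * (f (x (K + 1)) + hSurrogate h θ z (K + 1) - objective f h xs)
        + W K * (n ^ 2 * θ K ^ 2 / (2 * γ) + n * θ K * μ / 2) * ‖z (K + 1) - xs‖ ^ 2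
      ≤ initialEnergy f h θ γ μ W xs
        + ∑ k ∈ Finset.range (K + 1),
          (W k * θ k * samplingNoise f h μ xs (z k) (w k) (idx k)
            + Lc * (W k * l1 (y k - w k) ^ 2)
            - (1 / (2 * γ) - Lc) * (W k * stepLen n θ δ k ^ 2)) := by
  have hV : ∀ k, 0 ≤ f (x k) + hSurrogate h θ z k - objective f h xs := fun k => by
    have h1 := hP.isMin (x k)
    have h2 := T.separable_le hθ hP.convex_h k
    have h3 : objective f h (x k) = f (x k) + separable h (x k) := rfl
    linarith
  induction K with
  | zero =>
    have h1 := mul_le_mul_of_nonneg_left (T.one_step hθ hP hLc hγ hh 0) (hW.pos 0).le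
    have h2 : f (x 0) + hSurrogate h θ z 0 = objective f h 0 := by
      simp [hSurrogate, objective, T.x_zero, T.z_zero]
    have h3 : ‖z 0 - xs‖ = ‖xs‖ := by simp [T.z_zero]
    rw [h2, h3] at h1
    rw [zero_add, Finset.sum_range_one]
    unfold initialEnergy
    linarith
  | succ K ih =>
    have h1 := mul_le_mul_of_nonneg_left (T.one_step hθ hP hLc hγ hh (K + 1))
      (hW.pos (K + 1)).le
    have h2 := mul_le_mul_of_nonneg_right (hW.value_le K) (hV (K + 1))
    have h3 := mul_le_mul_of_nonneg_right (hW.dist_le K) (sq_nonneg ‖z (K + 1) - xs‖)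
    rw [Finset.sum_range_succ]
    linarith

/-- Along every trajectory the weighted error is bounded by the initial energy and the accumulated
sampling noise. -/
lemma IsTrajectory.error_le (T : IsTrajectory f h θ γ idx j x y z w δ)
    (hθ : IsAdmissible n θ) {Lc μ : ℝ} {xs : Vec n} (hP : IsProblem f h Lc xs) (hLc : 0 ≤ Lc)
    (hγ : 0 < γ) (hμ : 0 ≤ μ) (hh : ∀ i, StrongConvexOn Set.univ μ (h i)) {τ : ℕ}
    (hjk : ∀ k, j k ≤ k) (hkj : ∀ k, k ≤ j k + τ) {r : ℝ} {W : ℕ → ℝ}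
    (hW : IsWeight n τ θ γ μ r W) (hstep : Lc + Lc * r * delayMass n τ ^ 2 ≤ 1 / (2 * γ))
    (K : ℕ) :
    W K * (objective f h (x (K + 1)) - objective f h xs)
      ≤ initialEnergy f h θ γ μ W xs + ∑ k ∈ Finset.range (K + 1),
          W k * θ k * samplingNoise f h μ xs (z k) (w k) (idx k) := by
  have h1 := T.energy_le hθ hP hLc hγ hh hW K
  have h2 : W K * (objective f h (x (K + 1)) - objective f h xs)
      ≤ W K * (f (x (K + 1)) + hSurrogate h θ z (K + 1) - objective f h xs) := by
    refine mul_le_mul_of_nonneg_left ?_ (hW.pos K).le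
    have h3 := T.separable_le hθ hP.convex_h (K + 1)
    have h4 : objective f h (x (K + 1)) = f (x (K + 1)) + separable h (x (K + 1)) := rfl
    linarith
  have h3 : 0 ≤ W K * (n ^ 2 * θ K ^ 2 / (2 * γ) + n * θ K * μ / 2) * ‖z (K + 1) - xs‖ ^ 2 := by
    have := hW.pos K
    have := hθ.pos K
    positivity
  have h4 := mul_le_mul_of_nonneg_left (T.sum_l1_sub_sq_le hθ hjk hkj hW (K + 1)) hLc
  have h5 : 0 ≤ ∑ l ∈ Finset.range (K + 1), W l * stepLen n θ δ l ^ 2 :=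
    Finset.sum_nonneg fun l _ => mul_nonneg (hW.pos l).le (sq_nonneg _)
  have h6 := mul_le_mul_of_nonneg_right hstep h5
  rw [Finset.sum_sub_distrib, Finset.sum_add_distrib, ← Finset.mul_sum, ← Finset.mul_sum] at h1
  linarith

end Path

/-! ### Expectations -/

section Determined

variable {n : ℕ} {f : Vec n → ℝ} {h : Fin n → ℝ → ℝ} {θ : ℕ → ℝ} {γ : ℝ}
  {idx idx' : ℕ → Fin n} {j j' : ℕ → ℕ} {x y z w x' y' z' w' : ℕ → Vec n} {δ δ' : ℕ → ℝ}

/-- The minimization defining `δᵏ` has a unique solution, so the choices of the coordinates and of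
the read states determine the trajectory. -/
lemma IsTrajectory.state_congr (T : IsTrajectory f h θ γ idx j x y z w δ)
    (T' : IsTrajectory f h θ γ idx' j' x' y' z' w' δ') (hh : ∀ i, ConvexOn ℝ Set.univ (h i))
    (hθ : IsAdmissible n θ) (hγ : 0 < γ) (hj : ∀ k, j k ≤ k) (k : ℕ)
    (hidx : ∀ l < k, idx l = idx' l) (hjj : ∀ l < k, j l = j' l) :
    x k = x' k ∧ z k = z' k := by
  induction k using Nat.strong_induction_on with
  | _ k ih =>
    rcases k with _ | k
    · simp [T.x_zero, T'.x_zero, T.z_zero, T'.z_zero]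
    have hm : ∀ m ≤ k, x m = x' m ∧ z m = z' m := fun m hmk =>
      ih m (by omega) (fun l hl => hidx l (by omega)) fun l hl => hjj l (by omega)
    have hy : ∀ m ≤ k, y m = y' m := fun m hmk => by
      rw [T.y_eq, T'.y_eq, (hm m hmk).1, (hm m hmk).2]
    have hw : w k = w' k := by
      rw [T.w_eq, T'.w_eq, ← hjj k (by omega), hy _ (hj k), (hm _ (hj k)).1]
    obtain ⟨hxk, hzk⟩ := hm k le_rfl
    have hn : (0 : ℝ) < n := by linarith [hθ.one_le]
    have hq : 0 < n * θ k / γ := div_pos (mul_pos hn (hθ.pos k)) hγ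
    have e2 : (n : ℝ) * θ k / γ / 2 = n * θ k / (2 * γ) := by field_simp
    have hδ : δ k = δ' k := by
      refine prox_unique (z := z k (idx k)) (g := gradient f (w k) (idx k)) (hh (idx k)) hq ?_ ?_
      · rw [e2]; exact T.δ_isMin k
      · rw [e2, hidx k (by omega), hzk, hw]; exact T'.δ_isMin k
    have hz : z (k + 1) = z' (k + 1) := by
      rw [T.z_succ, T'.z_succ, hzk, hδ, hidx k (by omega)]
    exact ⟨by rw [T.x_succ, T'.x_succ, hz, hxk, hzk], hz⟩

lemma IsTrajectory.read_congr (T : IsTrajectory f h θ γ idx j x y z w δ)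
    (T' : IsTrajectory f h θ γ idx' j' x' y' z' w' δ') (hh : ∀ i, ConvexOn ℝ Set.univ (h i))
    (hθ : IsAdmissible n θ) (hγ : 0 < γ) (hj : ∀ k, j k ≤ k) (k : ℕ)
    (hidx : ∀ l < k, idx l = idx' l) (hjj : ∀ l ≤ k, j l = j' l) : w k = w' k := by
  obtain ⟨hx, hz⟩ := T.state_congr T' hh hθ hγ hj (j k)
    (fun l hl => hidx l (hl.trans_le (hj k))) fun l hl => hjj l (hl.le.trans (hj k))
  rw [T.w_eq, T'.w_eq, T.y_eq, T'.y_eq, ← hjj k le_rfl, hx, hz]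

end Determined

section Random

variable {n : ℕ} {Ω : Type*} {mΩ : MeasurableSpace Ω} {P : Measure Ω} {ℱ : Filtration ℕ mΩ}
  {τ : ℕ} {idx : ℕ → Ω → Fin n} {j : ℕ → Ω → ℕ}

/-- The choices that determine `xᵏ`, `zᵏ` and `wᵏ`, recorded in a finite type. -/
def history (idx : ℕ → Ω → Fin n) (j : ℕ → Ω → ℕ) (k : ℕ) (ω : Ω) :
    (Fin k → Fin n) × (Fin (k + 1) → Fin (k + 1)) :=
  (fun l => idx l ω, fun l => Fin.ofNat (k + 1) (j l ω))

lemma IsExecution.measurable_history (hE : IsExecution P ℱ τ idx j) (k : ℕ) :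
    Measurable[ℱ k] (history idx j k) := by
  change Measurable[ℱ k] fun ω => ((fun l : Fin k => idx l ω,
    fun l : Fin (k + 1) => Fin.ofNat (k + 1) (j l ω)) :
      (Fin k → Fin n) × (Fin (k + 1) → Fin (k + 1)))
  refine Measurable.prodMk ?_ ?_
  · refine @measurable_pi_lambda _ _ _ (ℱ k) _ _ fun l => ?_
    exact (hE.idx_measurable l).mono (ℱ.mono l.2) le_rfl
  · refine @measurable_pi_lambda _ _ _ (ℱ k) _ _ fun l => ?_
    have h1 : Measurable[ℱ k] (j l) :=
      (hE.j_measurable l).mono (ℱ.mono (Nat.lt_succ_iff.1 l.2)) le_rfl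
    exact (Measurable.of_discrete (f := Fin.ofNat (k + 1))).comp h1

lemma IsExecution.history_eq (hE : IsExecution P ℱ τ idx j) {k : ℕ} {ω ω' : Ω}
    (hH : history idx j k ω = history idx j k ω') :
    (∀ l < k, idx l ω = idx l ω') ∧ ∀ l ≤ k, j l ω = j l ω' := by
  simp only [history, Prod.mk.injEq, funext_iff] at hH
  refine ⟨fun l hl => hH.1 ⟨l, hl⟩, fun l hl => ?_⟩
  have h1 := congrArg Fin.val (hH.2 ⟨l, by omega⟩)
  simp only [Fin.ofNat] at h1
  rwa [Nat.mod_eq_of_lt (by have := hE.j_le l ω; omega),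
    Nat.mod_eq_of_lt (by have := hE.j_le l ω'; omega)] at h1

/-- A quantity determined by the choices up to the draw of `idx k` is measurable with respect to the
past and takes finitely many values. -/
lemma IsExecution.of_determined [IsFiniteMeasure P] (hE : IsExecution P ℱ τ idx j) {k : ℕ}
    {φ : Ω → ℝ} (hφ : ∀ ω ω', history idx j k ω = history idx j k ω' → φ ω = φ ω') :
    Measurable[ℱ k] φ ∧ Integrable φ P := by
  obtain ⟨e, rfl⟩ := (Function.factorsThrough_iff (f := history idx j k) φ).1
    (fun ω ω' hH => hφ ω ω' hH)
  have h1 := hE.measurable_history k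
  exact ⟨(Measurable.of_discrete (f := e)).comp h1,
    (Integrable.of_finite (f := e)).comp_measurable (h1.mono (ℱ.le k) le_rfl)⟩

/-- A uniform choice that is independent of the past averages over the coordinates. -/
lemma IsExecution.integral_sampled [IsProbabilityMeasure P] (hE : IsExecution P ℱ τ idx j)
    (k : ℕ) {φ : Fin n → Ω → ℝ} (hm : ∀ i, Measurable[ℱ k] (φ i))
    (hint : ∀ i, Integrable (φ i) P) :
    Integrable (fun ω => φ (idx k ω) ω) P ∧
      ∫ ω, φ (idx k ω) ω ∂P = (n : ℝ)⁻¹ * ∑ i, ∫ ω, φ i ω ∂P := by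
  have hidx : Measurable (idx k) := (hE.idx_measurable k).mono (ℱ.le _) le_rfl
  have hset : ∀ i, MeasurableSet (idx k ⁻¹' {i}) := fun i => hidx (measurableSet_singleton i)
  have hsplit : (fun ω => φ (idx k ω) ω)
      = fun ω => ∑ i, (idx k ⁻¹' {i}).indicator (φ i) ω := by
    funext ω
    rw [Finset.sum_eq_single (idx k ω)]
    · simp
    · intro i _ hi
      exact Set.indicator_of_notMem (fun h => hi (by simpa using h.symm)) _
    · simp
  have hone : ∀ i, ∫ ω, (idx k ⁻¹' {i}).indicator (φ i) ω ∂P = (n : ℝ)⁻¹ * ∫ ω, φ i ω ∂P := by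
    intro i
    have hind : IndepFun ((idx k ⁻¹' {i}).indicator (fun _ => (1 : ℝ))) (φ i) P := by
      rw [IndepFun_iff_Indep]
      refine indep_of_indep_of_le (hE.idx_indep k) ?_ (hm i).comap_le
      refine Measurable.comap_le ?_
      exact Measurable.indicator measurable_const ⟨{i}, trivial, rfl⟩
    have h1 := hind.integral_fun_mul_eq_mul_integral
      (aestronglyMeasurable_const.indicator (hset i)) (hint i).aestronglyMeasurable
    have h2 : ∀ ω, (idx k ⁻¹' {i}).indicator (fun _ => (1 : ℝ)) ω * φ i ω
        = (idx k ⁻¹' {i}).indicator (φ i) ω := fun ω => by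
      by_cases hω : ω ∈ idx k ⁻¹' {i} <;> simp [hω]
    simp only [h2] at h1
    rw [h1, integral_indicator_const _ (hset i), measureReal_def, hE.idx_uniform k i]
    simp
  rw [hsplit]
  refine ⟨integrable_finsetSum _ fun i _ => (hint i).indicator (hset i), ?_⟩
  rw [integral_finsetSum _ fun i _ => (hint i).indicator (hset i), Finset.mul_sum]
  exact Finset.sum_congr rfl fun i _ => hone i

variable {f : Vec n → ℝ} {h : Fin n → ℝ → ℝ} {θ : ℕ → ℝ} {γ : ℝ}
  {x y z w : ℕ → Ω → Vec n} {δ : ℕ → Ω → ℝ}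

lemma integrable_objective [IsProbabilityMeasure P] (hE : IsExecution P ℱ τ idx j)
    (hT : ∀ ω, IsTrajectory f h θ γ (fun k => idx k ω) (fun k => j k ω) (fun k => x k ω)
      (fun k => y k ω) (fun k => z k ω) (fun k => w k ω) (fun k => δ k ω))
    (hh : ∀ i, ConvexOn ℝ Set.univ (h i)) (hθ : IsAdmissible n θ) (hγ : 0 < γ) (k : ℕ) :
    Integrable (fun ω => objective f h (x k ω)) P := by
  refine (hE.of_determined (k := k) fun ω ω' hH => ?_).2
  obtain ⟨h1, h2⟩ := hE.history_eq hH
  have h3 := (hT ω).state_congr (hT ω') hh hθ hγ (fun l => hE.j_le l ω) k h1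
    fun l hl => h2 l hl.le
  exact congrArg (objective f h) h3.1

lemma integral_samplingNoise [IsProbabilityMeasure P] (hE : IsExecution P ℱ τ idx j)
    (hT : ∀ ω, IsTrajectory f h θ γ (fun k => idx k ω) (fun k => j k ω) (fun k => x k ω)
      (fun k => y k ω) (fun k => z k ω) (fun k => w k ω) (fun k => δ k ω))
    (hh : ∀ i, ConvexOn ℝ Set.univ (h i)) (hθ : IsAdmissible n θ) (hγ : 0 < γ)
    (μ : ℝ) (xs : Vec n) (k : ℕ) :
    Integrable (fun ω => samplingNoise f h μ xs (z k ω) (w k ω) (idx k ω)) P ∧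
      ∫ ω, samplingNoise f h μ xs (z k ω) (w k ω) (idx k ω) ∂P = 0 := by
  have hn : (n : ℝ) ≠ 0 := by linarith [hθ.one_le]
  have hdet : ∀ i, Measurable[ℱ k] (fun ω => coordGain f h μ xs (z k ω) (w k ω) i) ∧
      Integrable (fun ω => coordGain f h μ xs (z k ω) (w k ω) i) P := by
    intro i
    refine hE.of_determined fun ω ω' hH => ?_
    obtain ⟨h1, h2⟩ := hE.history_eq hH
    have h3 := (hT ω).state_congr (hT ω') hh hθ hγ (fun l => hE.j_le l ω) k h1
      fun l hl => h2 l hl.le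
    have h4 := (hT ω).read_congr (hT ω') hh hθ hγ (fun l => hE.j_le l ω) k h1 h2
    simp only [h3.2, h4]
  obtain ⟨h1, h2⟩ := hE.integral_sampled k (fun i => (hdet i).1) fun i => (hdet i).2
  have h3 : Integrable (fun ω => ∑ i, coordGain f h μ xs (z k ω) (w k ω) i) P :=
    integrable_finsetSum _ fun i _ => (hdet i).2
  unfold samplingNoise
  refine ⟨(h1.const_mul _).sub h3, ?_⟩
  rw [integral_sub (h1.const_mul _) h3, integral_const_mul, h2,
    integral_finsetSum _ fun i _ => (hdet i).2]
  field_simp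
  ring

/-- The convergence estimate in expectation. -/
lemma integral_error_le [IsProbabilityMeasure P] (hE : IsExecution P ℱ τ idx j)
    (hT : ∀ ω, IsTrajectory f h θ γ (fun k => idx k ω) (fun k => j k ω) (fun k => x k ω)
      (fun k => y k ω) (fun k => z k ω) (fun k => w k ω) (fun k => δ k ω))
    (hθ : IsAdmissible n θ) {Lc μ : ℝ} {xs : Vec n} (hP : IsProblem f h Lc xs) (hLc : 0 ≤ Lc)
    (hγ : 0 < γ) (hμ : 0 ≤ μ) (hh : ∀ i, StrongConvexOn Set.univ μ (h i)) {r : ℝ} {W : ℕ → ℝ}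
    (hW : IsWeight n τ θ γ μ r W) (hstep : Lc + Lc * r * delayMass n τ ^ 2 ≤ 1 / (2 * γ))
    (K : ℕ) :
    W K * (∫ ω, objective f h (x (K + 1) ω) ∂P - objective f h xs)
      ≤ initialEnergy f h θ γ μ W xs := by
  have hF := integrable_objective hE hT hP.convex_h hθ hγ (K + 1)
  have hN := fun k => integral_samplingNoise hE hT hP.convex_h hθ hγ μ xs k
  have h1 : ∀ ω, W K * (objective f h (x (K + 1) ω) - objective f h xs)
      ≤ initialEnergy f h θ γ μ W xs + ∑ k ∈ Finset.range (K + 1),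
          W k * θ k * samplingNoise f h μ xs (z k ω) (w k ω) (idx k ω) := fun ω =>
    (hT ω).error_le hθ hP hLc hγ hμ hh (fun k => hE.j_le k ω) (fun k => hE.le_j_add k ω) hW
      hstep K
  have hsum : Integrable (fun ω => ∑ k ∈ Finset.range (K + 1),
      W k * θ k * samplingNoise f h μ xs (z k ω) (w k ω) (idx k ω)) P :=
    integrable_finsetSum _ fun k _ => (hN k).1.const_mul _
  have h2 := integral_mono ((hF.sub (integrable_const _)).const_mul (W K))
    ((integrable_const (initialEnergy f h θ γ μ W xs)).add hsum) h1
  have h3 : ∫ ω, ∑ k ∈ Finset.range (K + 1),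
      W k * θ k * samplingNoise f h μ xs (z k ω) (w k ω) (idx k ω) ∂P = 0 := by
    rw [integral_finsetSum _ fun k _ => (hN k).1.const_mul _]
    exact Finset.sum_eq_zero fun k _ => by rw [integral_const_mul, (hN k).2, mul_zero]
  simp only [Pi.add_apply, Pi.sub_apply] at h2
  rw [integral_const_mul, integral_sub hF (integrable_const _),
    integral_add (integrable_const _) hsum, h3] at h2
  simpa using h2

end Random

/-! ### The two parameter sequences -/

lemma oracleCalls_eq (k : ℕ) : oracleCalls k = k := by
  induction k with
  | zero => rfl
  | succ k ih => rw [oracleCalls, ih]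

lemma delayMass_nonneg (n τ : ℕ) : 0 ≤ delayMass n τ := by unfold delayMass; positivity

lemma delayMass_le {n τ : ℕ} (hn : (1 : ℝ) ≤ n) (hτ : (τ : ℝ) ^ 2 ≤ n) :
    delayMass n τ ≤ 2 * τ := by
  have h0 : (0 : ℝ) ≤ τ := Nat.cast_nonneg τ
  have h1 : (τ : ℝ) ≤ n := by
    exact_mod_cast (Nat.le_self_pow two_ne_zero τ).trans (by exact_mod_cast hτ)
  have h2 : ((τ : ℝ) ^ 2 + τ) / n ≤ 2 * τ := by
    rw [div_le_iff₀ (by linarith)]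
    nlinarith
  unfold delayMass
  linarith

lemma stepNC_eq (n τ : ℕ) (Lc γ : ℝ) :
    stepNC n τ Lc γ = γ * Lc * (2 + 4 * (1 + 1 / n) * delayMass n τ ^ 2) := by
  unfold stepNC delayMass; ring

lemma stepSC_eq (n τ : ℕ) (Lc γ : ℝ) :
    stepSC n τ Lc γ = γ * Lc * (2 + 4 * (3 / 4 + 3 / (8 * n)) * delayMass n τ ^ 2) := by
  unfold stepSC delayMass; ring

/-- The left-hand sides of the step size conditions are `γ Lc` times a factor of order
`max(τ, 1)²`. -/
lemma step_factor_le {n τ : ℕ} (hn : (1 : ℝ) ≤ n) (hτ : (τ : ℝ) ^ 2 ≤ n) {a b : ℝ}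
    (ha : 0 ≤ a) (hab : a ≤ b) :
    2 + 4 * a * delayMass n τ ^ 2 ≤ 2 + 16 * b * (τ : ℝ) ^ 2 := by
  have h1 := pow_le_pow_left₀ (delayMass_nonneg n τ) (delayMass_le hn hτ) 2
  have h2 := mul_le_mul hab h1 (sq_nonneg _) (ha.trans hab)
  linarith

lemma pos_of_step {γ Lc s : ℝ} (hγ : 0 < γ) (hs : 0 ≤ s) (h : 0 < γ * Lc * s) : 0 < Lc := by
  by_contra hcon
  push Not at hcon
  have := mul_nonpos_of_nonpos_of_nonneg (mul_nonpos_of_nonneg_of_nonpos hγ.le hcon) hs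
  linarith

lemma isAdmissible_thetaNC {n : ℕ} (hn : (1 : ℝ) ≤ n) : IsAdmissible n (thetaNC n) where
  one_le := hn
  pos k := by unfold thetaNC; positivity
  mul_le_one k := by
    unfold thetaNC
    rw [← mul_div_assoc, div_le_one (by positivity)]
    have : (0 : ℝ) ≤ k := Nat.cast_nonneg k
    linarith
  anti k := by
    unfold thetaNC
    push_cast
    gcongr
    linarith

lemma isWeight_thetaNC {n τ : ℕ} (hn : (1 : ℝ) ≤ n) (hτ : (τ : ℝ) ^ 2 ≤ n) {γ : ℝ}
    (hγ : 0 < γ) :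
    IsWeight n τ (thetaNC n) γ 0 (2 * (1 + 1 / n)) (fun k => (2 * n + k : ℝ) ^ 2 / 4) where
  pos k := by positivity
  value_le k := by
    have h1 : (0 : ℝ) < 2 * n + (k + 1) := by positivity
    simp only [thetaNC]
    push_cast
    rw [one_sub_div h1.ne']
    field_simp
    nlinarith
  dist_le k := by
    simp only [thetaNC]
    push_cast
    apply le_of_eq
    field_simp
    ring
  growth l k hlk hk := by
    have hl : (0 : ℝ) ≤ l := Nat.cast_nonneg l
    have h1 : (2 * n + k : ℝ) ≤ (2 * n + l) + τ := by
      have : (k : ℝ) ≤ l + τ := by exact_mod_cast hk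
      linarith
    have h2 : (2 * n + k : ℝ) ^ 2 ≤ 2 * (2 * n + l) ^ 2 + 2 * n := by
      -- `(a + τ)² ≤ 2 a² + 2 τ²`, and `τ² ≤ n`
      refine (pow_le_pow_left₀ (by positivity) h1 2).trans ?_
      nlinarith [sq_nonneg ((2 * n + l : ℝ) - τ)]
    have h3 : (n : ℝ) ≤ 1 / n * (2 * n + l) ^ 2 := by
      rw [one_div, inv_mul_eq_div, le_div_iff₀ (by linarith)]
      nlinarith
    linarith

/-- `n θ` solves the quadratic equation that makes the decay of the distance term match the decay
`1 - θ` of the objective. -/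
lemma thetaSC_root {n : ℕ} (hn : (1 : ℝ) ≤ n) {γ μ : ℝ} (ha : 0 < γ * μ) (k : ℕ) :
    0 < thetaSC n γ μ k ∧
      (n * thetaSC n γ μ k) ^ 2 + γ * μ * (n * thetaSC n γ μ k) = γ * μ := by
  set a := γ * μ with haa
  have h1 : γ ^ 2 * μ ^ 2 + 4 * γ * μ = a ^ 2 + 4 * a := by rw [haa]; ring
  have h2 : Real.sqrt (a ^ 2 + 4 * a) ^ 2 = a ^ 2 + 4 * a := Real.sq_sqrt (by positivity)
  have h3 : a < Real.sqrt (a ^ 2 + 4 * a) := Real.lt_sqrt_of_sq_lt (by linarith)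
  have h4 : (n : ℝ) * thetaSC n γ μ k = (-a + Real.sqrt (a ^ 2 + 4 * a)) / 2 := by
    unfold thetaSC
    rw [h1]
    field_simp
    rw [haa]
  refine ⟨?_, ?_⟩
  · unfold thetaSC
    rw [h1]
    exact div_pos (by linarith) (by linarith)
  · rw [h4]
    linear_combination h2 / 4

lemma mul_thetaSC_lt_one {n : ℕ} (hn : (1 : ℝ) ≤ n) {γ μ : ℝ} (ha : 0 < γ * μ) (k : ℕ) :
    n * thetaSC n γ μ k < 1 := by
  obtain ⟨h1, h2⟩ := thetaSC_root hn ha k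
  by_contra hcon
  push Not at hcon
  nlinarith

lemma isAdmissible_thetaSC {n : ℕ} (hn : (1 : ℝ) ≤ n) {γ μ : ℝ} (ha : 0 < γ * μ) :
    IsAdmissible n (thetaSC n γ μ) where
  one_le := hn
  pos k := (thetaSC_root hn ha k).1
  mul_le_one k := (mul_thetaSC_lt_one hn ha k).le
  anti _ := le_rfl

/-- The step size condition forces `θ ≤ 1 / (3 τ)`, so the weights grow by at most `3 / 2` within
the delay. -/
lemma mul_thetaSC_le {n τ : ℕ} (hn : (1 : ℝ) ≤ n) {γ μ Lc : ℝ} (ha : 0 < γ * μ)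
    (hle : γ * μ ≤ γ * Lc)
    (hstep : stepSC n τ Lc γ ≤ 1) (k : ℕ) : τ * thetaSC n γ μ k ≤ 1 / 3 := by
  obtain ⟨h1, h2⟩ := thetaSC_root hn ha k
  set t := thetaSC n γ μ k with ht
  have hn0 : (0 : ℝ) < n := by linarith
  have hτ0 : (0 : ℝ) ≤ τ := Nat.cast_nonneg τ
  have hg : 0 < γ * Lc := ha.trans_le hle
  rw [stepSC_eq] at hstep
  have h3 : (n * t) ^ 2 ≤ γ * Lc := by
    have : 0 < γ * μ * (n * t) := by positivity
    linarith
  have hm : τ ≤ delayMass n τ := by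
    unfold delayMass
    have : 0 ≤ ((τ : ℝ) ^ 2 + τ) / n := by positivity
    linarith
  have h4 : 9 * (τ : ℝ) ^ 2 * (γ * Lc) ≤ n ^ 2 := by
    have hq : 0 ≤ 3 / (8 * (n : ℝ)) := by positivity
    -- for `n = 1` the bound `3` for the coefficient of `τ²` is not enough, but `Q ≥ 3 τ` there
    rcases Nat.lt_or_ge n 2 with hlt | hge
    · obtain rfl : n = 1 := by
        have : 1 ≤ n := by exact_mod_cast hn
        omega
      have h5 : 3 / 2 * (τ : ℝ) ≤ delayMass 1 τ := by
        unfold delayMass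
        push_cast
        have := sq_nonneg (τ : ℝ)
        linarith
      have h6 := pow_le_pow_left₀ (by positivity) h5 2
      have h7 : 9 * (τ : ℝ) ^ 2
          ≤ 2 + 4 * (3 / 4 + 3 / (8 * ((1 : ℕ) : ℝ))) * delayMass 1 τ ^ 2 := by
        push_cast
        nlinarith
      have h8 := mul_le_mul_of_nonneg_left h7 hg.le
      push_cast
      push_cast at h8 hstep
      linarith
    · have h5 : (2 : ℝ) ≤ n := by exact_mod_cast hge
      have h6 := pow_le_pow_left₀ hτ0 hm 2
      have h7 : 3 * (τ : ℝ) ^ 2 ≤ 2 + 4 * (3 / 4 + 3 / (8 * (n : ℝ))) * delayMass n τ ^ 2 := by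
        have := mul_nonneg hq (sq_nonneg (delayMass n τ))
        linarith
      have h8 := mul_le_mul_of_nonneg_left h7 hg.le
      nlinarith
  have h5 : (3 * τ * t) ^ 2 ≤ 1 := by
    have h6 : 9 * (τ : ℝ) ^ 2 * (n * t) ^ 2 ≤ n ^ 2 :=
      (mul_le_mul_of_nonneg_left h3 (by positivity)).trans h4
    have h7 : (n : ℝ) ^ 2 * (3 * τ * t) ^ 2 ≤ n ^ 2 * 1 := by linarith
    exact le_of_mul_le_mul_left h7 (by positivity)
  have h6 := (sq_le_one_iff₀ (by positivity)).1 h5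
  linarith

lemma isWeight_thetaSC {n τ : ℕ} (hn : (1 : ℝ) ≤ n) {γ μ : ℝ} (hγ : 0 < γ) (hμ : 0 < μ)
    (hτ : τ * thetaSC n γ μ 0 ≤ 1 / 3) :
    IsWeight n τ (thetaSC n γ μ) γ μ (2 * (3 / 4 + 3 / (8 * n)))
      (fun k => ((1 - thetaSC n γ μ 0) ^ (k + 1))⁻¹) := by
  have ha := mul_pos hγ hμ
  obtain ⟨h1, h2⟩ := thetaSC_root hn ha 0
  have hθ : ∀ k, thetaSC n γ μ k = thetaSC n γ μ 0 := fun _ => rfl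
  have hlt := mul_thetaSC_lt_one hn ha 0
  set t := thetaSC n γ μ 0 with ht
  have ht1 : 0 < 1 - t := by nlinarith
  refine ⟨fun k => by positivity, fun k => ?_, fun k => ?_, fun l k hlk hk => ?_⟩
  · rw [hθ (k + 1), pow_succ (1 - t) (k + 1), mul_inv, mul_assoc, inv_mul_cancel₀ ht1.ne', mul_one]
  · rw [hθ (k + 1), hθ k, pow_succ (1 - t) (k + 1), mul_inv, mul_assoc]
    refine mul_le_mul_of_nonneg_left (le_of_eq ?_) (by positivity)
    rw [inv_mul_eq_iff_eq_mul₀ ht1.ne']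
    field_simp
    linear_combination h2
  · have h3 : (1 - t) ^ (k + 1) = (1 - t) ^ (l + 1) * (1 - t) ^ (k - l) := by
      rw [← pow_add]; congr 1; omega
    have h4 : 2 / 3 ≤ (1 - t) ^ (k - l) := by
      have h5 := one_add_mul_le_pow (show (-2 : ℝ) ≤ -t by linarith) τ
      have h6 : (1 - t) ^ τ ≤ (1 - t) ^ (k - l) :=
        pow_le_pow_of_le_one ht1.le (by linarith) (by omega)
      rw [← sub_eq_add_neg] at h5
      linarith
    have h5 : 3 / 2 ≤ 2 * (3 / 4 + 3 / (8 * (n : ℝ))) := by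
      have : 0 ≤ 3 / (8 * (n : ℝ)) := by positivity
      linarith
    rw [h3, mul_inv, mul_comm]
    refine mul_le_mul_of_nonneg_right ?_ (by positivity)
    refine le_trans ?_ h5
    rw [inv_le_comm₀ (by positivity) (by norm_num)]
    linarith

/-- `θ` is at least of order `√(γ μ) / n`. -/
lemma le_mul_thetaSC_sq {n : ℕ} (hn : (1 : ℝ) ≤ n) {γ μ : ℝ} (ha : 0 < γ * μ)
    (ha2 : γ * μ ≤ 1 / 2) (k : ℕ) : γ * μ ≤ 4 * (n * thetaSC n γ μ k) ^ 2 := by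
  obtain ⟨h1, h2⟩ := thetaSC_root hn ha k
  set X := (n : ℝ) * thetaSC n γ μ k with hX
  by_contra hcon
  push Not at hcon
  have h3 : X < 1 / 2 := by nlinarith
  nlinarith

/-- The minimizer of a strongly convex composite objective is close to any point of small error. -/
lemma sq_norm_le {n : ℕ} {f : Vec n → ℝ} {h : Fin n → ℝ → ℝ} {Lc μ : ℝ} {xs : Vec n}
    (hP : IsProblem f h Lc xs) (hh : StrongConvexOn Set.univ μ (separable h)) :
    μ / 2 * ‖xs‖ ^ 2 ≤ objective f h 0 - objective f h xs := by
  have h1 : StrongConvexOn Set.univ μ (objective f h) := by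
    have h2 : objective f h = separable h + f := by
      funext v; simp only [objective, Pi.add_apply]; ring
    rw [h2]
    have h3 := UniformConvexOn.add hh (uniformConvexOn_zero.2 hP.convex_f)
    simpa [StrongConvexOn] using h3
  have h2 := growth_of_isMin h1 hP.isMin 0
  rw [sub_zero] at h2
  linarith

/-! ### Rates of convergence in expectation -/

section Rates

variable {n : ℕ} {Ω : Type*} {mΩ : MeasurableSpace Ω} {P : Measure Ω} {ℱ : Filtration ℕ mΩ}
  {τ : ℕ} {idx : ℕ → Ω → Fin n} {j : ℕ → Ω → ℕ}
  {f : Vec n → ℝ} {h : Fin n → ℝ → ℝ} {γ Lc : ℝ} {xs : Vec n}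
  {x y z w : ℕ → Ω → Vec n} {δ : ℕ → Ω → ℝ}

lemma one_le_dim (P : Measure Ω) [IsProbabilityMeasure P] (idx : ℕ → Ω → Fin n) :
    (1 : ℝ) ≤ n := by
  obtain ⟨ω⟩ := nonempty_of_isProbabilityMeasure P
  have := (idx 0 ω).pos
  exact_mod_cast this

lemma error_nonneg [IsProbabilityMeasure P] (hP : IsProblem f h Lc xs) {k : ℕ}
    (hF : Integrable (fun ω => objective f h (x k ω)) P) :
    0 ≤ ∫ ω, objective f h (x k ω) ∂P - objective f h xs := by
  have h1 := integral_mono (integrable_const (objective f h xs)) hF fun ω => hP.isMin (x k ω)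
  simp only [integral_const, probReal_univ, one_smul] at h1
  linarith

lemma integral_zero [IsProbabilityMeasure P] {θ : ℕ → ℝ}
    (hT : ∀ ω, IsTrajectory f h θ γ (fun k => idx k ω) (fun k => j k ω) (fun k => x k ω)
      (fun k => y k ω) (fun k => z k ω) (fun k => w k ω) (fun k => δ k ω)) :
    ∫ ω, objective f h (x 0 ω) ∂P = objective f h 0 := by
  have h1 : ∀ ω, x 0 ω = 0 := fun ω => (hT ω).x_zero
  simp [h1]

/-- Without strong convexity the expected error decays like `n² / (k + 1)²`, for `k = 0` too. -/
lemma rate_thetaNC [IsProbabilityMeasure P] (hE : IsExecution P ℱ τ idx j)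
    (hT : ∀ ω, IsTrajectory f h (thetaNC n) γ (fun k => idx k ω) (fun k => j k ω)
      (fun k => x k ω) (fun k => y k ω) (fun k => z k ω) (fun k => w k ω) (fun k => δ k ω))
    (hP : IsProblem f h Lc xs) (hLc : 0 ≤ Lc) (hγ : 0 < γ) (hτ : (τ : ℝ) ^ 2 ≤ n)
    (hstep : stepNC n τ Lc γ ≤ 1) (k : ℕ) :
    ((k : ℝ) + 1) ^ 2 * (∫ ω, objective f h (x k ω) ∂P - objective f h xs)
      ≤ 4 * n ^ 2 * (objective f h 0 - objective f h xs + ‖xs‖ ^ 2 / (2 * γ)) := by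
  have hn := one_le_dim P idx
  have hn0 : (0 : ℝ) < n := by linarith
  have hθ := isAdmissible_thetaNC hn
  have hV : 0 ≤ objective f h 0 - objective f h xs := sub_nonneg.2 (hP.isMin 0)
  have hD : 0 ≤ ‖xs‖ ^ 2 / (2 * γ) := by positivity
  rcases k with _ | K
  · rw [integral_zero hT]
    have h1 : (1 : ℝ) ≤ 4 * n ^ 2 := by nlinarith
    have h2 := le_mul_of_one_le_left (add_nonneg hV hD) h1
    simp only [Nat.cast_zero, zero_add, one_pow, one_mul]
    linarith
  · have hst : Lc + Lc * (2 * (1 + 1 / n)) * delayMass n τ ^ 2 ≤ 1 / (2 * γ) := by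
      rw [le_div_iff₀ (by positivity)]
      rw [stepNC_eq] at hstep
      linarith
    have h1 := integral_error_le hE hT hθ hP hLc hγ le_rfl
      (fun i => strongConvexOn_zero.2 (hP.convex_h i)) (isWeight_thetaNC hn hτ hγ) hst K
    have h2 := error_nonneg (k := K + 1) hP (integrable_objective hE hT hP.convex_h hθ hγ (K + 1))
    set err := ∫ ω, objective f h (x (K + 1) ω) ∂P - objective f h xs with herr
    have h3 : initialEnergy f h (thetaNC n) γ 0 (fun k => (2 * n + k : ℝ) ^ 2 / 4) xs
        = n ^ 2 * (objective f h 0 - objective f h xs + ‖xs‖ ^ 2 / (2 * γ))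
          - n * (objective f h 0 - objective f h xs) := by
      simp only [initialEnergy, thetaNC, Nat.cast_zero, add_zero]
      field_simp
      ring
    have h4 : ((K : ℝ) + 1 + 1) ^ 2 ≤ (2 * n + K) ^ 2 :=
      pow_le_pow_left₀ (by positivity) (by linarith) 2
    have h5 := mul_le_mul_of_nonneg_right h4 h2
    have h6 := mul_nonneg hn0.le hV
    rw [h3] at h1
    push_cast
    linarith

/-- With strong convexity the expected error decays like `(1 - θ)ᵏ`. The distance term of the
initial energy is `μ / 2 ‖x*‖²`, which is at most the initial error. -/
lemma rate_thetaSC [IsProbabilityMeasure P] (hE : IsExecution P ℱ τ idx j) {μ : ℝ}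
    (hT : ∀ ω, IsTrajectory f h (thetaSC n γ μ) γ (fun k => idx k ω) (fun k => j k ω)
      (fun k => x k ω) (fun k => y k ω) (fun k => z k ω) (fun k => w k ω) (fun k => δ k ω))
    (hP : IsProblem f h Lc xs) (hh : StrongConvexOn Set.univ μ (separable h)) (hμ : 0 < μ)
    (hμL : μ ≤ Lc) (hγ : 0 < γ) (hstep : stepSC n τ Lc γ ≤ 1) (k : ℕ) :
    ∫ ω, objective f h (x k ω) ∂P - objective f h xs
      ≤ (1 - thetaSC n γ μ 0) ^ k * (2 * (objective f h 0 - objective f h xs)) := by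
  have hn := one_le_dim P idx
  have hn0 : (0 : ℝ) < n := by linarith
  have ha := mul_pos hγ hμ
  have hθ := isAdmissible_thetaSC hn ha
  have hV : 0 ≤ objective f h 0 - objective f h xs := sub_nonneg.2 (hP.isMin 0)
  obtain ⟨hr1, hr2⟩ := thetaSC_root hn ha 0
  have ht1 : 0 < 1 - thetaSC n γ μ 0 := by
    have := mul_thetaSC_lt_one hn ha 0
    nlinarith
  rcases k with _ | K
  · rw [integral_zero hT, pow_zero]
    linarith
  · have hst : Lc + Lc * (2 * (3 / 4 + 3 / (8 * n))) * delayMass n τ ^ 2 ≤ 1 / (2 * γ) := by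
      rw [le_div_iff₀ (by positivity)]
      have := hstep
      rw [stepSC_eq] at this
      linarith
    have hτ := mul_thetaSC_le hn ha (mul_le_mul_of_nonneg_left hμL hγ.le) hstep 0
    have h1 := integral_error_le hE hT hθ hP (hμ.le.trans hμL) hγ hμ.le
      (strongConvexOn_coord hh) (isWeight_thetaSC hn hγ hμ hτ) hst K
    set t := thetaSC n γ μ 0 with ht
    have h3 : initialEnergy f h (thetaSC n γ μ) γ μ (fun k => ((1 - t) ^ (k + 1))⁻¹) xs
        = objective f h 0 - objective f h xs + μ / 2 * ‖xs‖ ^ 2 := by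
      have h4 : n ^ 2 * t ^ 2 / (2 * γ) + (n - 1) * t * μ / 2 = (1 - t) * (μ / 2) := by
        field_simp
        linear_combination hr2
      simp only [initialEnergy, ← ht]
      rw [h4, zero_add, pow_one]
      field_simp
    have h5 := sq_norm_le hP hh
    rw [h3, inv_mul_le_iff₀ (by positivity)] at h1
    exact h1.trans (mul_le_mul_of_nonneg_left (by linarith) (by positivity))

end Rates

end AASCD

theorem corollary2 :
    (∀ c A R : ℝ, 0 < c → ∃ C : ℝ, 0 < C ∧
      ∀ (n τ : ℕ) (f : AASCD.Vec n → ℝ) (h : Fin n → ℝ → ℝ) (L Lc γ ε : ℝ) (xstar : AASCD.Vec n)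
        (Ω : Type*) (mΩ : MeasurableSpace Ω) (P : Measure Ω) (_ : IsProbabilityMeasure P)
        (ℱ : Filtration ℕ mΩ) (idx : ℕ → Ω → Fin n) (j : ℕ → Ω → ℕ)
        (x y z w : ℕ → Ω → AASCD.Vec n) (δ : ℕ → Ω → ℝ),
        AASCD.IsProblem f h Lc xstar →
        AASCD.LipschitzGradient f L → Lc ≤ L →
        AASCD.objective f h 0 - AASCD.objective f h xstar ≤ A * L →
        ‖xstar‖ ≤ R →
        (τ : ℝ) ≤ Real.sqrt n →
        0 < γ → c ≤ AASCD.stepNC n τ Lc γ → AASCD.stepNC n τ Lc γ ≤ 1 →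
        AASCD.IsExecution P ℱ τ idx j →
        (∀ ω, AASCD.IsTrajectory f h (AASCD.thetaNC n) γ (fun k => idx k ω) (fun k => j k ω)
          (fun k => x k ω) (fun k => y k ω) (fun k => z k ω) (fun k => w k ω)
          (fun k => δ k ω)) →
        0 < ε →
        ∃ N : ℕ, (N : ℝ) ≤ C * ((n * Real.sqrt L + n * τ * Real.sqrt Lc) * Real.sqrt (1 / ε)) ∧
          AASCD.ReachesAccuracy P (AASCD.objective f h) xstar x ε N) ∧
    (∀ c A : ℝ, 0 < c → ∃ C : ℝ, 0 < C ∧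
      ∀ (n τ : ℕ) (f : AASCD.Vec n → ℝ) (h : Fin n → ℝ → ℝ) (Lc μ γ ε : ℝ) (xstar : AASCD.Vec n)
        (Ω : Type*) (mΩ : MeasurableSpace Ω) (P : Measure Ω) (_ : IsProbabilityMeasure P)
        (ℱ : Filtration ℕ mΩ) (idx : ℕ → Ω → Fin n) (j : ℕ → Ω → ℕ)
        (x y z w : ℕ → Ω → AASCD.Vec n) (δ : ℕ → Ω → ℝ),
        AASCD.IsProblem f h Lc xstar →
        StrongConvexOn Set.univ μ (AASCD.separable h) → 0 < μ → μ ≤ Lc →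
        AASCD.objective f h 0 - AASCD.objective f h xstar ≤ A →
        (τ : ℝ) ≤ Real.sqrt n →
        0 < γ → c ≤ AASCD.stepSC n τ Lc γ → AASCD.stepSC n τ Lc γ ≤ 1 →
        AASCD.IsExecution P ℱ τ idx j →
        (∀ ω, AASCD.IsTrajectory f h (AASCD.thetaSC n γ μ) γ (fun k => idx k ω) (fun k => j k ω)
          (fun k => x k ω) (fun k => y k ω) (fun k => z k ω) (fun k => w k ω)
          (fun k => δ k ω)) →
        0 < ε → ε ≤ 1 / 2 →
        ∃ N : ℕ, (N : ℝ) ≤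
            C * (n * (max τ 1 : ℕ) * Real.sqrt (Lc / μ) * Real.log (1 / ε)) ∧
          AASCD.ReachesAccuracy P (AASCD.objective f h) xstar x ε N) := by
  refine ⟨fun c A R hc => ?_, fun c A hc => ?_⟩
  · set B : ℝ := 4 * |A| + 72 * (R ^ 2 / c) + 1 with hB
    have hB0 : 0 < B := by positivity
    refine ⟨Real.sqrt B, Real.sqrt_pos.2 hB0, ?_⟩
    intro n τ f h L Lc γ ε xs Ω mΩ P _ ℱ idx j x y z w δ hP _ hLcL hA hR hτ hγ hcs hs1 hE hT hε
    have hn := AASCD.one_le_dim P idx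
    have hn0 : (0 : ℝ) < n := by linarith
    have hτ2 : (τ : ℝ) ^ 2 ≤ n := (Real.le_sqrt (by positivity) (by positivity)).1 hτ
    have hcs' := hcs
    rw [AASCD.stepNC_eq] at hcs'
    have hLc : 0 < Lc := AASCD.pos_of_step hγ (by positivity) (hc.trans_le hcs')
    have hL : 0 < L := hLc.trans_le hLcL
    set S : ℝ := n * Real.sqrt L + n * τ * Real.sqrt Lc with hS
    have hS0 : 0 ≤ S := by positivity
    have hS2 : n ^ 2 * L + n ^ 2 * τ ^ 2 * Lc ≤ S ^ 2 := by
      have h1 : 0 ≤ n * Real.sqrt L * (n * τ * Real.sqrt Lc) := by positivity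
      have h2 := Real.sq_sqrt hL.le
      have h3 := Real.sq_sqrt hLc.le
      have h4 : S ^ 2 = n ^ 2 * Real.sqrt L ^ 2 + n ^ 2 * τ ^ 2 * Real.sqrt Lc ^ 2
          + 2 * (n * Real.sqrt L * (n * τ * Real.sqrt Lc)) := by rw [hS]; ring
      rw [h4, h2, h3]
      linarith
    -- the step size condition from below bounds `1 / γ` by a multiple of `Lc max(τ, 1)²`
    have hγinv : ‖xs‖ ^ 2 / (2 * γ) ≤ (R ^ 2 / c) * (L + 16 * (τ ^ 2 * Lc)) := by
      have h1 : 1 + 1 / (n : ℝ) ≤ 2 := by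
        have : 1 / (n : ℝ) ≤ 1 := by rw [div_le_one hn0]; exact hn
        linarith
      have h2 := mul_le_mul_of_nonneg_left
        (AASCD.step_factor_le hn hτ2 (by positivity) h1) (mul_pos hγ hLc).le
      have h3 : c ≤ γ * (Lc * (2 + 32 * τ ^ 2)) := by linarith
      have h4 : c / (2 * γ) ≤ Lc + 16 * (τ ^ 2 * Lc) := by
        rw [div_le_iff₀ (by positivity)]
        linarith
      have h5 : ‖xs‖ ^ 2 ≤ R ^ 2 := pow_le_pow_left₀ (norm_nonneg _) hR 2
      have h6 : ‖xs‖ ^ 2 / (2 * γ) = ‖xs‖ ^ 2 / c * (c / (2 * γ)) := by field_simp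
      rw [h6]
      refine mul_le_mul (div_le_div_of_nonneg_right h5 hc.le) (h4.trans ?_) (by positivity)
        (by positivity)
      linarith
    have hbound : ∀ k : ℕ, ((k : ℝ) + 1) ^ 2 *
        (∫ ω, AASCD.objective f h (x k ω) ∂P - AASCD.objective f h xs) ≤ B * S ^ 2 := by
      intro k
      have h1 := AASCD.rate_thetaNC hE hT hP hLc.le hγ hτ2 hs1 k
      have h2 : A * L ≤ |A| * L := mul_le_mul_of_nonneg_right (le_abs_self A) hL.le
      have h3 : AASCD.objective f h 0 - AASCD.objective f h xs + ‖xs‖ ^ 2 / (2 * γ)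
          ≤ |A| * L + (R ^ 2 / c) * (L + 16 * (τ ^ 2 * Lc)) := by linarith
      refine h1.trans ((mul_le_mul_of_nonneg_left h3 (by positivity)).trans ?_)
      refine le_trans ?_ (mul_le_mul_of_nonneg_left hS2 hB0.le)
      have h4 : 0 ≤ R ^ 2 / c * (n ^ 2 * L) := by positivity
      have h5 : 0 ≤ R ^ 2 / c * (n ^ 2 * τ ^ 2 * Lc) := by positivity
      have h6 : 0 ≤ |A| * (n ^ 2 * τ ^ 2 * Lc) := by positivity
      have h7 : 0 ≤ n ^ 2 * L + n ^ 2 * τ ^ 2 * Lc := by positivity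
      rw [hB]
      linarith
    -- the right-hand side may be less than `1`; rounding down works as the rate is in `k + 1`
    refine ⟨⌊Real.sqrt B * (S * Real.sqrt (1 / ε))⌋₊, Nat.floor_le (by positivity), ?_⟩
    intro k hk
    rw [AASCD.oracleCalls_eq] at hk
    refine ⟨AASCD.integrable_objective hE hT hP.convex_h (AASCD.isAdmissible_thetaNC hn) hγ k, ?_⟩
    have h1 : Real.sqrt B * (S * Real.sqrt (1 / ε)) ≤ (k : ℝ) + 1 := by
      refine (Nat.lt_floor_add_one _).le.trans ?_
      have : ((⌊Real.sqrt B * (S * Real.sqrt (1 / ε))⌋₊ : ℕ) : ℝ) ≤ k := by exact_mod_cast hk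
      linarith
    have h2 := pow_le_pow_left₀ (by positivity) h1 2
    rw [mul_pow, mul_pow, Real.sq_sqrt hB0.le, Real.sq_sqrt (by positivity)] at h2
    have h3 : B * S ^ 2 ≤ ((k : ℝ) + 1) ^ 2 * ε := by
      have h4 := mul_le_mul_of_nonneg_right h2 hε.le
      have h5 : B * (S ^ 2 * (1 / ε)) * ε = B * S ^ 2 := by field_simp
      linarith
    exact le_of_mul_le_mul_left ((hbound k).trans h3) (by positivity)
  · set A' : ℝ := max (2 * A) 1 with hA'
    have hA1 : 1 ≤ A' := le_max_right _ _
    have hl2 : 0 < Real.log 2 := Real.log_pos one_lt_two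
    set κ : ℝ := Real.sqrt (80 / c) with hκ
    have hκ0 : 0 < κ := Real.sqrt_pos.2 (by positivity)
    set D : ℝ := Real.log A' / Real.log 2 + 1 with hD
    have hD0 : 0 < D := by
      have := div_nonneg (Real.log_nonneg hA1) hl2.le
      linarith
    -- the summand `1 / log 2` pays for rounding up, as `G log (1 / ε) ≥ log 2` for
    -- `G = n max(τ, 1) √(Lc / μ)`
    refine ⟨κ * D + 1 / Real.log 2, by positivity, ?_⟩
    intro n τ f h Lc μ γ ε xs Ω mΩ P _ ℱ idx j x y z w δ hP hh hμ hμL hA hτ hγ hcs hs1 hE hT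
      hε hε2
    have hn := AASCD.one_le_dim P idx
    have hn0 : (0 : ℝ) < n := by linarith
    have hτ2 : (τ : ℝ) ^ 2 ≤ n := (Real.le_sqrt (by positivity) (by positivity)).1 hτ
    have hLc : 0 < Lc := hμ.trans_le hμL
    have ha := mul_pos hγ hμ
    set M : ℝ := ((max τ 1 : ℕ) : ℝ) with hM
    have hM1 : 1 ≤ M := by rw [hM]; exact_mod_cast le_max_right τ 1
    have hMτ : (τ : ℝ) ≤ M := by rw [hM]; exact_mod_cast le_max_left τ 1
    set G : ℝ := n * M * Real.sqrt (Lc / μ) with hG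
    have hG1 : 1 ≤ G := by
      have h1 : 1 ≤ Real.sqrt (Lc / μ) := by
        rw [Real.one_le_sqrt, one_le_div hμ]
        exact hμL
      exact one_le_mul_of_one_le_of_one_le (one_le_mul_of_one_le_of_one_le hn hM1) h1
    set ℓ : ℝ := Real.log (1 / ε) with hℓ
    have hℓ2 : Real.log 2 ≤ ℓ := by
      refine Real.log_le_log two_pos ?_
      rw [le_div_iff₀ hε]
      linarith
    have hℓ0 : 0 < ℓ := hl2.trans_le hℓ2
    set t := AASCD.thetaSC n γ μ 0 with ht
    obtain ⟨ht0, -⟩ := AASCD.thetaSC_root hn ha 0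
    rw [← ht] at ht0
    -- the parameter `θ` is at least of order `1 / G`
    have htG : 1 ≤ t * (κ * G) := by
      have h1 : γ * μ ≤ γ * Lc := mul_le_mul_of_nonneg_left hμL hγ.le
      have hγLc : 0 < γ * Lc := mul_pos hγ hLc
      have h2 : γ * μ ≤ 1 / 2 := by
        have h3 := hs1
        rw [AASCD.stepSC_eq] at h3
        have h4 : 0 ≤ γ * Lc * (4 * (3 / 4 + 3 / (8 * n)) * AASCD.delayMass n τ ^ 2) := by
          positivity
        linarith
      have h3 := AASCD.le_mul_thetaSC_sq hn ha h2 0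
      rw [← ht] at h3
      have h4 : 3 / 4 + 3 / (8 * (n : ℝ)) ≤ 9 / 8 := by
        have : 3 / (8 * (n : ℝ)) ≤ 3 / 8 := by
          rw [div_le_div_iff₀ (by positivity) (by norm_num)]
          linarith
        linarith
      have h5 := hcs
      rw [AASCD.stepSC_eq] at h5
      have h6 : c ≤ γ * Lc * (20 * M ^ 2) := by
        refine h5.trans (mul_le_mul_of_nonneg_left
          ((AASCD.step_factor_le hn hτ2 (by positivity) h4).trans ?_) hγLc.le)
        have h7 := pow_le_pow_left₀ (by positivity) hMτ 2
        have h8 : 1 ≤ M ^ 2 := one_le_pow₀ hM1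
        linarith
      have h7 : c * μ ≤ 80 * (Lc * M ^ 2 * (n * t) ^ 2) := by
        have h8 := mul_le_mul_of_nonneg_right h6 hμ.le
        have h9 := mul_le_mul_of_nonneg_left h3
          (show 0 ≤ 20 * (Lc * M ^ 2) by positivity)
        linarith
      have h8 : 1 ≤ (t * (κ * G)) ^ 2 := by
        have h9 : (t * (κ * G)) ^ 2 = 80 * (Lc * M ^ 2 * (n * t) ^ 2) / (c * μ) := by
          rw [hG, mul_pow, mul_pow, mul_pow, hκ, Real.sq_sqrt (by positivity),
            Real.sq_sqrt (by positivity)]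
          field_simp
        rw [h9, one_le_div (by positivity)]
        exact h7
      exact (one_le_sq_iff₀ (by positivity)).1 h8
    refine ⟨⌈κ * G * (D * ℓ)⌉₊, ?_, ?_⟩
    · have h1 := (Nat.ceil_lt_add_one (show 0 ≤ κ * G * (D * ℓ) by positivity)).le
      have h2 : 1 ≤ 1 / Real.log 2 * (G * ℓ) := by
        rw [one_div, inv_mul_eq_div, one_le_div hl2]
        exact hℓ2.trans (le_mul_of_one_le_left hℓ0.le hG1)
      linarith
    · intro k hk
      rw [AASCD.oracleCalls_eq] at hk
      refine ⟨AASCD.integrable_objective hE hT hP.convex_h (AASCD.isAdmissible_thetaSC hn ha) hγ k,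
        (AASCD.rate_thetaSC hE hT hP hh hμ hμL hγ hs1 k).trans ?_⟩
      have ht1 : 0 ≤ 1 - t := sub_nonneg.2 ((AASCD.isAdmissible_thetaSC hn ha).le_one 0)
      have h1 : κ * G * (D * ℓ) ≤ k := (Nat.le_ceil _).trans (by exact_mod_cast hk)
      have h2 : Real.log (A' / ε) ≤ t * k := by
        have h3 : Real.log (A' / ε) = Real.log A' + ℓ := by
          rw [hℓ, div_eq_mul_one_div, Real.log_mul (by positivity) (by positivity)]
        have h4 : Real.log A' ≤ Real.log A' / Real.log 2 * ℓ := by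
          rw [div_mul_eq_mul_div, le_div_iff₀ hl2]
          exact mul_le_mul_of_nonneg_left hℓ2 (Real.log_nonneg hA1)
        have h5 := mul_le_mul_of_nonneg_left h1 ht0.le
        have h6 := mul_le_mul_of_nonneg_right htG (mul_pos hD0 hℓ0).le
        have h7 : D * ℓ = Real.log A' / Real.log 2 * ℓ + ℓ := by rw [hD]; ring
        linarith
      have h3 : (1 - t) ^ k ≤ Real.exp (-(t * k)) := by
        have h4 := pow_le_pow_left₀ ht1 (Real.one_sub_le_exp_neg t) k
        rw [← Real.exp_nat_mul] at h4
        refine h4.trans (le_of_eq ?_)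
        congr 1
        ring
      have h4 : Real.exp (-(t * k)) ≤ ε / A' := by
        rw [← Real.le_log_iff_exp_le (by positivity), ← inv_div, Real.log_inv]
        linarith
      have h5 : 2 * (AASCD.objective f h 0 - AASCD.objective f h xs) ≤ A' :=
        le_trans (by linarith) (le_max_left _ _)
      calc (1 - t) ^ k * (2 * (AASCD.objective f h 0 - AASCD.objective f h xs))
          ≤ (1 - t) ^ k * A' := mul_le_mul_of_nonneg_left h5 (pow_nonneg ht1 k)
        _ ≤ ε / A' * A' := mul_le_mul_of_nonneg_right (h3.trans h4) (by positivity)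
        _ = ε := by field_simp
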